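/- Let $0<\beta_0<\beta_1<1$ and let $\mu$ be a Borel measure on $\mathbb R$ with support exactly $[\beta_0,\beta_1]$ and with a (measurable, nonnegative) density, $\mu(d\beta)=p(\beta)\,d\beta$, such that $\beta\mapsto\Gamma(1-\beta)p(\beta)$ is $C^1$ on $[\beta_0,\beta_1]$ and $$C(\beta_0,\beta_1,p)=\int_{\beta_0}^{\beta_1}\sin(\beta\pi)\,\Gamma(1-\beta)\,p(\beta)\,d\beta>0 .$$ Let $(W_\tau)_{\tau\ge0}$ be the driftless subordinator whose Lévy measure $\phi_W$ on $(0,\infty)$ has tail $\phi_W(t,\infty)=\int_0^1t^{-\beta}\,\mu(d\beta)$, that is, $\mathbb E[e^{-sW_\tau}]=e^{-\tau\psi_W(s)}$ with $\psi_W(s)=\int_0^\infty(1-e^{-sx})\,\phi_W(dx)$. Let $E_t=\inf\{\tau\ge 0:W_\tau>t\}$ be its inverse and $h(t,\lambda)=\mathbb E[e^{-\lambda E_t}]$. For a function $u$ of $t$ let $$\mathbb D^{(\nu)}u(t)=\int_0^1\Bigl(\frac1{\Gamma(1-\beta)}\int_0^t\frac{u'(r)\,dr}{(t-r)^\beta}\Bigr)\nu(d\beta),\qquad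 \nu(d\beta)=\Gamma(1-\beta)\,\mu(d\beta).$$ Then for every $\lambda>0$: (a) $t\mapsto h(t,\lambda)$ is differentiable on $(0,\infty)$ and, for all $t>0$, $|\partial_th(t,\lambda)|\le\lambda\,k(t)$, where $$k(t)=[C(\beta_0,\beta_1,p)\,\pi]^{-1}\bigl[\Gamma(1-\beta_1)t^{\beta_1-1}+\Gamma(1-\beta_0)t^{\beta_0-1}\bigr];$$ (b) $h(\cdot,\lambda)$ is a classical solution of the eigenvalue problem $\mathbb D^{(\nu)}h(t,\lambda)=-\lambda h(t,\lambda)$, $h(0,\lambda)=1$: it is continuous on $[0,\infty)$ and $C^1$ on $(0,\infty)$, for every $t>0$ the double integral defining $\mathbb D^{(\nu)}h(t,\lambda)$ converges absolutely, the equation holds at every $t>0$, and $h(0,\lambda)=1$. -/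

import Mathlib

open Set MeasureTheory ProbabilityTheory
open scoped NNReal ENNReal

noncomputable section

namespace DistributedOrder

/-- The Lévy measure `φ_W` on `(0, ∞)` of the power-law mixture with mixing measure `μ` on `(0, 1)`.
It is the measure with tail `φ_W (t, ∞) = ∫_(0,1) t ^ (-β) μ(dβ)` for `t > 0`
(see `mixtureLevyMeasure_Ioi`), written here through its density
`x ↦ ∫_(0,1) β * x ^ (-β - 1) μ(dβ)`. -/
def mixtureLevyMeasure (μ : Measure ℝ) : Measure ℝ :=
  (volume.restrict (Ioi (0 : ℝ))).withDensity
    fun x => ∫⁻ β in Ioo (0 : ℝ) 1, ENNReal.ofReal (β * x ^ (-β - 1)) ∂μ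

/-- The tail of the mixture Lévy measure. -/
theorem mixtureLevyMeasure_Ioi (μ : Measure ℝ) [SFinite μ] {t : ℝ} (ht : 0 < t) :
    mixtureLevyMeasure μ (Ioi t) =
      ∫⁻ β in Ioo (0 : ℝ) 1, ENNReal.ofReal (t ^ (-β)) ∂μ := by
  have hm : Measurable (fun q : ℝ × ℝ => ENNReal.ofReal (q.2 * q.1 ^ (-q.2 - 1))) := by
    fun_prop
  rw [mixtureLevyMeasure, withDensity_apply _ measurableSet_Ioi,
    Measure.restrict_restrict measurableSet_Ioi,
    inter_eq_left.2 (Ioi_subset_Ioi ht.le), lintegral_lintegral_swap hm.aemeasurable]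
  refine setLIntegral_congr_fun measurableSet_Ioo fun β hβ => ?_
  have hlt : -β - 1 < -1 := by linarith [hβ.1]
  have hint : IntegrableOn (fun x : ℝ => β * x ^ (-β - 1)) (Ioi t) :=
    (integrableOn_Ioi_rpow_of_lt hlt ht).const_mul β
  change ∫⁻ x in Ioi t, ENNReal.ofReal (β * x ^ (-β - 1)) = ENNReal.ofReal (t ^ (-β))
  rw [← ofReal_integral_eq_lintegral_ofReal hint]
  · congr 1
    rw [integral_const_mul, integral_Ioi_rpow_of_lt hlt ht]
    have hb : β ≠ 0 := hβ.1.ne'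
    rw [show -β - 1 + 1 = -β by ring]
    field_simp
  · refine (ae_restrict_iff' measurableSet_Ioi).2 (Filter.Eventually.of_forall fun x hx => ?_)
    have hx0 : (0 : ℝ) < x := ht.trans hx
    have hb : (0 : ℝ) < β := hβ.1
    exact mul_nonneg hb.le (Real.rpow_nonneg hx0.le _)

/-- The Laplace exponent `ψ(s) = ∫_(0,∞) (1 - e^(-s x)) φ(dx)` of a driftless subordinator with
Lévy measure `φ`. -/
def laplaceExponent (φ : Measure ℝ) (s : ℝ) : ℝ :=
  ∫ x in Ioi (0 : ℝ), (1 - Real.exp (-(s * x))) ∂φ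

/-- `W` is a (driftless, real-valued) subordinator with Lévy measure `φ`: it starts at `0`, has
independent and stationary increments, its paths are almost surely nondecreasing and
right-continuous (left limits are then automatic), and `E[e^(-s W_τ)] = e^(-τ ψ(s))`. -/
structure IsSubordinator {Ω : Type*} [MeasurableSpace Ω] (P : Measure Ω)
    (W : ℝ≥0 → Ω → ℝ) (φ : Measure ℝ) : Prop where
  measurable : ∀ τ, Measurable (W τ)
  zero : ∀ᵐ ω ∂P, W 0 ω = 0
  indep : HasIndepIncrements W P
  stationary : ∀ σ τ : ℝ≥0, IdentDistrib (fun ω => W (σ + τ) ω - W σ ω) (W τ) P P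
  mono : ∀ᵐ ω ∂P, Monotone fun τ => W τ ω
  rightCont : ∀ᵐ ω ∂P, ∀ τ, ContinuousWithinAt (fun σ => W σ ω) (Ici τ) τ
  levy_null : φ (Iic 0) = 0
  levy_integrable : ∫⁻ x in Ioi (0 : ℝ), ENNReal.ofReal (min 1 x) ∂φ < ∞
  laplace : ∀ (τ : ℝ≥0) (s : ℝ), 0 ≤ s →
    ∫ ω, Real.exp (-(s * W τ ω)) ∂P = Real.exp (-(τ * laplaceExponent φ s))

/-- The inverse (first passage time) `E_t = inf {τ ≥ 0 : W_τ > t}`. -/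
def inverseProcess {Ω : Type*} (W : ℝ≥0 → Ω → ℝ) (t : ℝ) (ω : Ω) : ℝ :=
  sInf ((fun τ : ℝ≥0 => (τ : ℝ)) '' {τ : ℝ≥0 | t < W τ ω})

/-- `h(t, λ) = E[e^(-λ E_t)]`. -/
def laplaceInverse {Ω : Type*} [MeasurableSpace Ω] (P : Measure Ω) (W : ℝ≥0 → Ω → ℝ)
    (t lam : ℝ) : ℝ :=
  ∫ ω, Real.exp (-(lam * inverseProcess W t ω)) ∂P

/-- The Caputo derivative of order `β ∈ (0, 1)`. -/
def caputoDeriv (β : ℝ) (u : ℝ → ℝ) (t : ℝ) : ℝ :=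
  (Real.Gamma (1 - β))⁻¹ * ∫ r in Ioo 0 t, deriv u r * (t - r) ^ (-β)

/-- The measure `ν(dβ) = Γ(1 - β) μ(dβ)` on `(0, 1)`. -/
def orderMeasure (μ : Measure ℝ) : Measure ℝ :=
  (μ.restrict (Ioo 0 1)).withDensity fun β => ENNReal.ofReal (Real.Gamma (1 - β))

/-- The distributed order derivative `D^(ν) u (t) = ∫_(0,1) (∂^β u / ∂t^β)(t) ν(dβ)`. -/
def distributedDeriv (μ : Measure ℝ) (u : ℝ → ℝ) (t : ℝ) : ℝ :=
  ∫ β, caputoDeriv β u t ∂(orderMeasure μ)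

/-- The double integral (in `r ∈ (0, t)` and in `β` against `ν`) that defines `D^(ν) u (t)`
converges absolutely. -/
def DistributedDerivExists (μ : Measure ℝ) (u : ℝ → ℝ) (t : ℝ) : Prop :=
  Integrable
    (fun q : ℝ × ℝ => (Real.Gamma (1 - q.1))⁻¹ * (deriv u q.2 * (t - q.2) ^ (-q.1)))
    ((orderMeasure μ).prod (volume.restrict (Ioo 0 t)))

/-- `u` is a classical solution of `D^(ν) u (t) = -λ u(t)`, `u(0) = 1`. -/
structure IsClassicalEigenSolution (μ : Measure ℝ) (lam : ℝ) (u : ℝ → ℝ) : Prop where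
  continuousOn : ContinuousOn u (Ici 0)
  contDiffOn : ContDiffOn ℝ 1 u (Ioi 0)
  deriv_exists : ∀ t, 0 < t → DistributedDerivExists μ u t
  equation : ∀ t, 0 < t → distributedDeriv μ u t = -lam * u t
  initial : u 0 = 1

/-- `C(β₀, β₁, p) = ∫_{β₀}^{β₁} sin(βπ) Γ(1 - β) p(β) dβ`. -/
def boundConst (b0 b1 : ℝ) (p : ℝ → ℝ) : ℝ :=
  ∫ β in b0..b1, Real.sin (β * Real.pi) * Real.Gamma (1 - β) * p β

/-- `k(t) = [C π]⁻¹ (Γ(1 - β₁) t^(β₁ - 1) + Γ(1 - β₀) t^(β₀ - 1))`. -/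
def boundFun (b0 b1 : ℝ) (p : ℝ → ℝ) (t : ℝ) : ℝ :=
  (boundConst b0 b1 p * Real.pi)⁻¹ *
    (Real.Gamma (1 - b1) * t ^ (b1 - 1) + Real.Gamma (1 - b0) * t ^ (b0 - 1))

end DistributedOrder

end

/-! Write `ν` for `orderMeasure μ` and `ψ(s) = ∫ s^β ν(dβ)`. Integrating by parts against the tail
of the Lévy measure gives `ψ_W = ψ`, and the tail has Laplace transform `ψ(s)/s`. Let `T` be
exponential of rate `λ`, independent of `W`. Since `E_t > τ` and `W_τ ≤ t` are equally likely for
almost every `τ`, `h(t, λ)` is the probability that `W_T > t`, and `W_T` has Laplace transform `λ/(λ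
+ ψ(s))`.

The core is a Stieltjes representation of `1/(λ + ψ)`. In the coordinate `z = log s` the function
`ψ` is entire, the cut plane becomes a strip, and the upper edge of the cut is the line `Im z = π`.
`le_norm_add_complexMGF` bounds the denominator from below there by `∫ e^(β Re z) sin(βπ) ν(dβ)`,
which is where `C` enters. Cauchy's theorem on rectangles in `0 ≤ Im z ≤ π` then yields `1/(λ +
ψ(s)) = ∫ ρ(r)/(s + r) dr` with `0 ≤ ρ(r) ≤ (Cπ)⁻¹ (r^(-β₁) + r^(-β₀))`. So `1/(λ + ψ)` is the
Laplace transform of `f(t) = ∫ e^(-tr) ρ(r) dr` (`laplace_resolventKernel`), and integrating the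
bound on `ρ` gives `f ≤ k` (`resolventKernel_le`).

By uniqueness of Laplace transforms `W_T` has density `λ f`. Hence `h(t) = 1 - λ ∫_0^t f` and `h' =
-λ f`, which gives (a) and the regularity in (b).

For the equation, the Gamma factors of `ν` and of the Caputo derivative cancel, so that `D^(ν) h` is
`-λ` times the convolution of `f` with the Lévy tail. That convolution has transform `ψ/(s(λ + ψ))`,
as does `h`, so the two agree almost everywhere, then everywhere by continuity
(`causalConv_eq_laplaceInverse`). All integrands have a fixed sign, so Tonelli supplies absolute
convergence along with the value. -/

noncomputable section

namespace DistributedOrder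

open Filter Topology

/-! ### Laplace transforms: uniqueness and basic formulas. -/

/-- A measure on `ℝ` with finite Laplace transform on `(0, ∞)` is determined by the latter. -/
theorem measure_ext_of_laplace {m₁ m₂ : Measure ℝ}
    (hfin : ∀ s : ℝ, 0 < s → ∫⁻ x, ENNReal.ofReal (Real.exp (-(s * x))) ∂m₁ ≠ ∞)
    (h : ∀ s : ℝ, 0 < s → ∫⁻ x, ENNReal.ofReal (Real.exp (-(s * x))) ∂m₁ =
      ∫⁻ x, ENNReal.ofReal (Real.exp (-(s * x))) ∂m₂) : m₁ = m₂ := by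
  -- Tilting by `e^(-x)` makes both measures finite, with exponential moments of every order below
  -- `1`. Their complex moment generating functions are then analytic on `Re z < 1`. Agreement at
  -- real points near `0` spreads by the identity theorem to the imaginary axis, that is, to the
  -- characteristic functions.
  set w : ℝ → ℝ≥0∞ := fun x => ENNReal.ofReal (Real.exp (-(1 * x))) with hw
  have hwm : Measurable w := by fun_prop
  have hfin₂ : ∀ s : ℝ, 0 < s → ∫⁻ x, ENNReal.ofReal (Real.exp (-(s * x))) ∂m₂ ≠ ∞ :=
    fun s hs => h s hs ▸ hfin s hs
  have tilt : ∀ (m : Measure ℝ) (t : ℝ),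
      ∫⁻ x, ENNReal.ofReal (Real.exp (t * x)) ∂(m.withDensity w) =
        ∫⁻ x, ENNReal.ofReal (Real.exp (-((1 - t) * x))) ∂m := by
    intro m t
    rw [lintegral_withDensity_eq_lintegral_mul _ hwm (by fun_prop)]
    refine lintegral_congr fun x => ?_
    simp only [hw, Pi.mul_apply]
    rw [← ENNReal.ofReal_mul (Real.exp_nonneg _), ← Real.exp_add]
    ring_nf
  have key : ∀ m : Measure ℝ,
      (∀ s : ℝ, 0 < s → ∫⁻ x, ENNReal.ofReal (Real.exp (-(s * x))) ∂m ≠ ∞) →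
      IsFiniteMeasure (m.withDensity w) ∧
      Iio (1 : ℝ) ⊆ integrableExpSet id (m.withDensity w) := by
    intro m hm
    refine ⟨isFiniteMeasure_withDensity (hm 1 one_pos), fun t ht => ?_⟩
    refine ⟨by fun_prop, ?_⟩
    rw [hasFiniteIntegral_iff_ofReal (Eventually.of_forall fun x => Real.exp_nonneg _)]
    simp only [id]
    rw [tilt]
    exact (hm _ (by simpa using ht)).lt_top
  obtain ⟨hf₁, hi₁⟩ := key m₁ hfin
  obtain ⟨hf₂, hi₂⟩ := key m₂ hfin₂
  have sub : ∀ m : Measure ℝ, Iio (1 : ℝ) ⊆ integrableExpSet id m →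
      AnalyticOnNhd ℂ (complexMGF id m) {z : ℂ | z.re < 1} := fun m hm =>
    analyticOnNhd_complexMGF.mono fun z hz => interior_mono hm (by simpa using hz)
  have heq : EqOn (complexMGF id (m₁.withDensity w)) (complexMGF id (m₂.withDensity w))
      {z : ℂ | z.re < 1} := by
    refine (sub _ hi₁).eqOn_of_preconnected_of_frequently_eq (sub _ hi₂)
      (convex_halfSpace_re_lt 1).isPreconnected (z₀ := 0) (by simp) ?_
    have hreal : ∀ t : ℝ, t < 1 →
        complexMGF id (m₁.withDensity w) t = complexMGF id (m₂.withDensity w) t := by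
      intro t ht
      rw [complexMGF_ofReal, complexMGF_ofReal, mgf, mgf,
        integral_eq_lintegral_of_nonneg_ae (Eventually.of_forall fun x => Real.exp_nonneg _)
          (by fun_prop),
        integral_eq_lintegral_of_nonneg_ae (Eventually.of_forall fun x => Real.exp_nonneg _)
          (by fun_prop)]
      simp only [id]
      rw [tilt, tilt, h _ (by linarith)]
    have hev : ∃ᶠ t : ℝ in 𝓝[≠] 0,
        complexMGF id (m₁.withDensity w) t = complexMGF id (m₂.withDensity w) t := by
      apply Eventually.frequently
      filter_upwards [mem_nhdsWithin_of_mem_nhds (Iio_mem_nhds (zero_lt_one (α := ℝ)))] with t ht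
      exact hreal t ht
    have htend : Tendsto (fun t : ℝ => (t : ℂ)) (𝓝[≠] 0) (𝓝[≠] 0) := by
      refine tendsto_nhdsWithin_iff.2 ⟨?_, ?_⟩
      · exact (Complex.continuous_ofReal.tendsto' 0 0 (by simp)).mono_left nhdsWithin_le_nhds
      · filter_upwards [self_mem_nhdsWithin] with t ht
        simpa using ht
    exact htend.frequently hev
  have hEq : m₁.withDensity w = m₂.withDensity w := by
    refine Measure.ext_of_charFun ?_
    ext t
    rw [← complexMGF_id_mul_I, ← complexMGF_id_mul_I]
    exact heq (by simp)
  have hinv : ∀ m : Measure ℝ, (m.withDensity w).withDensity (fun x => (w x)⁻¹) = m := by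
    intro m
    refine withDensity_inv_same hwm (Eventually.of_forall fun x => ?_)
      (Eventually.of_forall fun x => ENNReal.ofReal_ne_top)
    simp [hw, Real.exp_pos]
  rw [← hinv m₁, hEq, hinv]

/-- Laplace transform of the tail of a measure on `[0, ∞)`. -/
theorem lintegral_tail_mul_exp (m : Measure ℝ) (hm : m (Iio 0) = 0) {s : ℝ} (hs : 0 < s) :
    ∫⁻ t in Ioi (0 : ℝ), m (Ioi t) * ENNReal.ofReal (Real.exp (-(s * t))) =
      ∫⁻ x, ENNReal.ofReal ((1 - Real.exp (-(s * x))) / s) ∂m := by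
  have hnn : (0 : ℝ → ℝ) ≤ᵐ[m] id := by
    refine (ae_iff.2 ?_ : ∀ᵐ x ∂m, 0 ≤ x)
    simpa [Iio] using hm
  have := lintegral_comp_eq_lintegral_meas_lt_mul m (f := id)
    (g := fun t => Real.exp (-(s * t))) hnn measurable_id.aemeasurable
    (fun t _ => (by fun_prop : Continuous fun t => Real.exp (-(s * t))).intervalIntegrable _ _)
    (Eventually.of_forall fun t => Real.exp_nonneg _)
  simp only [id] at this
  refine Eq.trans ?_ (this.symm.trans ?_)
  · rfl
  · refine lintegral_congr fun x => ?_
    congr 1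
    have hd : ∀ t ∈ uIcc 0 x, HasDerivAt (fun t => -(Real.exp (-(s * t)) / s))
        (Real.exp (-(s * t))) t := by
      intro t _
      exact (((((hasDerivAt_id t).const_mul s).neg.exp).div_const s).neg).congr_deriv (by
        simp only [id, Pi.neg_apply]; field_simp)
    rw [intervalIntegral.integral_eq_sub_of_hasDerivAt hd
      ((by fun_prop : Continuous fun t => Real.exp (-(s * t))).intervalIntegrable _ _)]
    simp
    ring

/-- The Laplace transform of a power. -/
theorem lintegral_rpow_mul_exp {a s : ℝ} (ha : a < 1) (hs : 0 < s) :
    ∫⁻ t in Ioi (0 : ℝ), ENNReal.ofReal (t ^ (-a)) * ENNReal.ofReal (Real.exp (-(s * t))) =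
      ENNReal.ofReal (Real.Gamma (1 - a) * s ^ (a - 1)) := by
  have hv := Real.integral_rpow_mul_exp_neg_mul_Ioi (a := 1 - a) (r := s) (by linarith) hs
  have hpos : 0 < Real.Gamma (1 - a) * s ^ (a - 1) :=
    mul_pos (Real.Gamma_pos_of_pos (by linarith)) (Real.rpow_pos_of_pos hs _)
  have hE : (1 / s) ^ (1 - a) * Real.Gamma (1 - a) = Real.Gamma (1 - a) * s ^ (a - 1) := by
    rw [mul_comm, one_div, Real.inv_rpow hs.le, ← Real.rpow_neg hs.le]
    congr 2; ring
  rw [hE] at hv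
  -- The Bochner integral of a non-integrable function is `0`, so the positive value in `hv` already
  -- forces integrability.
  have hint : Integrable (fun t : ℝ => t ^ (1 - a - 1) * Real.exp (-(s * t)))
      (volume.restrict (Ioi 0)) := by
    by_contra hcon
    rw [integral_undef hcon] at hv
    exact hpos.ne hv
  rw [← hv, ofReal_integral_eq_lintegral_ofReal hint]
  · refine setLIntegral_congr_fun measurableSet_Ioi fun t ht => ?_
    rw [← ENNReal.ofReal_mul (Real.rpow_nonneg (le_of_lt ht) _)]
    congr 3; ring
  · refine (ae_restrict_iff' measurableSet_Ioi).2 (Eventually.of_forall fun t ht => ?_)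
    exact mul_nonneg (Real.rpow_nonneg (le_of_lt ht) _) (Real.exp_nonneg _)

theorem lintegral_Ioi_exp {a : ℝ} (ha : 0 < a) :
    ∫⁻ t in Ioi (0 : ℝ), ENNReal.ofReal (Real.exp (-(a * t))) = ENNReal.ofReal a⁻¹ := by
  have := lintegral_rpow_mul_exp (a := 0) one_pos ha
  simpa [Real.rpow_neg_one] using this

/-! ### The inverse process and the subordinator at an exponential time. -/

/-- The law of `W` at an independent exponential time of rate `lam`. -/
def exponentialTimeLaw {Ω : Type*} [MeasurableSpace Ω] (P : Measure Ω) (W : ℝ≥0 → Ω → ℝ)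
    (lam : ℝ) : Measure ℝ :=
  ((volume.restrict (Ioi (0 : ℝ))).withDensity
    fun τ => ENNReal.ofReal (lam * Real.exp (-(lam * τ)))).bind fun τ => P.map (W τ.toNNReal)

theorem IsSubordinator.nonneg {Ω : Type*} [MeasurableSpace Ω] {P : Measure Ω} {W : ℝ≥0 → Ω → ℝ}
    {φ : Measure ℝ} (hW : IsSubordinator P W φ) :
    ∀ᵐ ω ∂P, ∀ τ, 0 ≤ W τ ω := by
  filter_upwards [hW.zero, hW.mono] with ω h0 hm τ
  exact h0 ▸ hm (zero_le (a := τ))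

theorem inverseProcess_nonneg {Ω : Type*} (W : ℝ≥0 → Ω → ℝ) (t : ℝ) (ω : Ω) : 0 ≤ inverseProcess W t ω := by
  refine Real.sInf_nonneg ?_
  rintro _ ⟨τ, -, rfl⟩
  exact τ.2

theorem inverseProcess_le {Ω : Type*} {W : ℝ≥0 → Ω → ℝ} {t : ℝ} {ω : Ω} {τ : ℝ≥0} (h : t < W τ ω) :
    inverseProcess W t ω ≤ τ := by
  refine csInf_le ⟨0, ?_⟩ ⟨τ, h, rfl⟩
  rintro _ ⟨τ, -, rfl⟩
  exact τ.2

theorem lt_of_inverseProcess_lt {Ω : Type*} {W : ℝ≥0 → Ω → ℝ} {t : ℝ} {ω : Ω}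
    (hm : Monotone fun τ => W τ ω)
    (hu : ∃ τ, t < W τ ω) {τ : ℝ≥0} (h : inverseProcess W t ω < τ) : t < W τ ω := by
  obtain ⟨σ₀, hσ₀⟩ := hu
  obtain ⟨_, ⟨σ, hσ, rfl⟩, hlt⟩ := exists_lt_of_csInf_lt (Set.Nonempty.image _ ⟨σ₀, hσ₀⟩) h
  exact lt_of_lt_of_le (show t < W σ ω from hσ) (hm (NNReal.coe_le_coe.1 hlt.le))

section Subordinator

variable {Ω : Type*} [MeasurableSpace Ω] {P : Measure Ω} [IsProbabilityMeasure P]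
  {W : ℝ≥0 → Ω → ℝ} {φ : Measure ℝ}

theorem IsSubordinator.lintegral_exp (hW : IsSubordinator P W φ) (τ : ℝ≥0) {s : ℝ} (hs : 0 ≤ s) :
    ∫⁻ ω, ENNReal.ofReal (Real.exp (-(s * W τ ω))) ∂P =
      ENNReal.ofReal (Real.exp (-(τ * laplaceExponent φ s))) := by
  have hm := hW.measurable τ
  rw [← hW.laplace τ s hs, ofReal_integral_eq_lintegral_ofReal]
  · refine Integrable.of_bound (by fun_prop) 1 ?_
    filter_upwards [hW.nonneg] with ω hω
    rw [Real.norm_eq_abs, Real.abs_exp, Real.exp_le_one_iff]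
    have := mul_nonneg hs (hω τ)
    linarith
  · exact Eventually.of_forall fun _ => Real.exp_nonneg _

/-- Markov's inequality for `e^(-W_τ)`. The exponential decay in `τ` gives unboundedness of almost
every path. -/
theorem IsSubordinator.measure_le (hW : IsSubordinator P W φ) (τ : ℝ≥0) (t : ℝ) :
    P {ω | W τ ω ≤ t} ≤
      ENNReal.ofReal (Real.exp t * Real.exp (-(τ * laplaceExponent φ 1))) := by
  have hm := hW.measurable τ
  have h := mul_meas_ge_le_lintegral (μ := P)
    (f := fun ω => ENNReal.ofReal (Real.exp (-(1 * W τ ω)))) (by fun_prop)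
    (ENNReal.ofReal (Real.exp (-t)))
  rw [hW.lintegral_exp τ zero_le_one] at h
  have hset : {ω | ENNReal.ofReal (Real.exp (-t)) ≤ ENNReal.ofReal (Real.exp (-(1 * W τ ω)))} =
      {ω | W τ ω ≤ t} := by
    ext ω
    simp [ENNReal.ofReal_le_ofReal_iff (Real.exp_nonneg _)]
  rw [hset] at h
  calc P {ω | W τ ω ≤ t}
      = ENNReal.ofReal (Real.exp t) * (ENNReal.ofReal (Real.exp (-t)) * P {ω | W τ ω ≤ t}) := by
        rw [← mul_assoc, ← ENNReal.ofReal_mul (Real.exp_nonneg _), ← Real.exp_add]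
        simp
    _ ≤ _ := by
        rw [ENNReal.ofReal_mul (Real.exp_nonneg _)]
        gcongr

theorem IsSubordinator.unbounded (hW : IsSubordinator P W φ) (hψ : 0 < laplaceExponent φ 1) :
    ∀ᵐ ω ∂P, ∀ t : ℝ, ∃ τ, t < W τ ω := by
  have hk : ∀ k : ℕ, ∀ᵐ ω ∂P, ∃ τ, (k : ℝ) < W τ ω := by
    intro k
    rw [ae_iff]
    have hle : ∀ n : ℕ, P {ω | ¬ ∃ τ, (k : ℝ) < W τ ω} ≤
        ENNReal.ofReal (Real.exp k * Real.exp (-(n * laplaceExponent φ 1))) := by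
      intro n
      refine (measure_mono fun ω hω => ?_).trans (hW.measure_le (n : ℝ≥0) k)
      simp only [not_exists, not_lt, mem_ofPred_eq] at hω
      exact hω n
    have hlim : Tendsto (fun n : ℕ =>
        ENNReal.ofReal (Real.exp k * Real.exp (-(n * laplaceExponent φ 1)))) atTop (𝓝 0) := by
      rw [← ENNReal.ofReal_zero]
      refine ENNReal.tendsto_ofReal ?_
      rw [← mul_zero (Real.exp k)]
      refine Tendsto.const_mul _ (Real.tendsto_exp_atBot.comp ?_)
      exact tendsto_neg_atTop_atBot.comp
        (tendsto_natCast_atTop_atTop.atTop_mul_const hψ)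
    exact le_antisymm (ge_of_tendsto' hlim hle) (zero_le)
  filter_upwards [ae_all_iff.2 hk] with ω hω t
  obtain ⟨k, hk⟩ := exists_nat_gt t
  obtain ⟨τ, hτ⟩ := hω k
  exact ⟨τ, hk.trans hτ⟩

theorem IsSubordinator.nullMeasurable_inverseProcess (hW : IsSubordinator P W φ)
    (hψ : 0 < laplaceExponent φ 1) (t : ℝ) : NullMeasurable (inverseProcess W t) P := by
  have key : ∀ c : ℝ, NullMeasurableSet {ω | inverseProcess W t ω < c} P := by
    intro c
    have hmeas : MeasurableSet (⋃ n : ℕ, {ω | (TopologicalSpace.denseSeq ℝ≥0 n : ℝ) < c ∧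
        t < W (TopologicalSpace.denseSeq ℝ≥0 n) ω}) := by
      refine MeasurableSet.iUnion fun n => ?_
      exact (MeasurableSet.const _).inter (measurableSet_lt measurable_const (hW.measurable _))
    -- Paths are monotone and unbounded only almost surely, so the event is only almost everywhere
    -- equal to a countable union over a dense set of times.
    refine hmeas.nullMeasurableSet.congr ?_
    filter_upwards [hW.mono, hW.unbounded hψ] with ω hm hu
    refine propext ?_
    change ω ∈ (⋃ n : ℕ, {ω | (TopologicalSpace.denseSeq ℝ≥0 n : ℝ) < c ∧
        t < W (TopologicalSpace.denseSeq ℝ≥0 n) ω}) ↔ inverseProcess W t ω < c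
    simp only [mem_iUnion, mem_ofPred_eq]
    constructor
    · rintro ⟨n, hn, hn'⟩
      exact (inverseProcess_le hn').trans_lt hn
    · intro hlt
      have h0 := inverseProcess_nonneg W t ω
      lift c to ℝ≥0 using h0.trans hlt.le
      have hlt' : (⟨inverseProcess W t ω, h0⟩ : ℝ≥0) < c := hlt
      obtain ⟨_, ⟨n, rfl⟩, h1, h2⟩ :=
        (TopologicalSpace.denseRange_denseSeq ℝ≥0).exists_between hlt'
      exact ⟨n, NNReal.coe_lt_coe.2 h2, lt_of_inverseProcess_lt hm (hu t) h1⟩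
  exact @measurable_of_Iio ℝ (NullMeasurableSpace Ω P) _ _ _ _ _ _ _ _ key

/-- The survival function of the inverse process, for almost every time. -/
theorem IsSubordinator.measure_inverseProcess_gt (hW : IsSubordinator P W φ)
    (hψ : 0 < laplaceExponent φ 1) (t : ℝ) :
    ∀ᵐ τ : ℝ ∂volume.restrict (Ioi 0),
      P {ω | τ < inverseProcess W t ω} = P {ω | W τ.toNNReal ω ≤ t} := by
  -- Pathwise, `τ < E_t` implies `W_τ ≤ t`, which implies `τ ≤ E_t`. The gap `E_t = τ` has positive
  -- probability for at most countably many `τ`.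
  have hc : {τ : ℝ | 0 < P {ω | inverseProcess W t ω = τ}}.Countable :=
    Measure.countable_meas_level_set_pos₀ (hW.nullMeasurable_inverseProcess hψ t)
  filter_upwards [ae_restrict_of_ae (hc.ae_notMem volume), ae_restrict_mem measurableSet_Ioi]
    with τ hτ hτ0
  have hτ' : ∀ᵐ ω ∂P, inverseProcess W t ω ≠ τ := by
    rw [ae_iff]
    simpa using hτ
  refine measure_congr ?_
  filter_upwards [hW.mono, hW.unbounded hψ, hτ'] with ω hm hu hne
  refine propext ?_
  change τ < inverseProcess W t ω ↔ W τ.toNNReal ω ≤ t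
  have hcoe : (τ.toNNReal : ℝ) = τ := Real.coe_toNNReal _ (le_of_lt hτ0)
  constructor
  · intro h
    by_contra! hlt
    exact absurd (hcoe ▸ inverseProcess_le hlt) (not_le.2 h)
  · intro h
    by_contra! hle
    exact absurd (lt_of_inverseProcess_lt hm (hu t) (hcoe.symm ▸ lt_of_le_of_ne hle hne))
      (not_lt.2 h)

theorem IsSubordinator.measurable_map (hW : IsSubordinator P W φ) :
    Measurable fun τ : ℝ => P.map (W τ.toNNReal) := by
  have : ∀ τ : ℝ, IsProbabilityMeasure (P.map (W τ.toNNReal)) := fun τ =>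
    Measure.isProbabilityMeasure_map (hW.measurable _).aemeasurable
  refine .measure_of_isPiSystem_of_isProbabilityMeasure (borel_eq_generateFrom_Iic ℝ)
    isPiSystem_Iic ?_
  rintro _ ⟨t, rfl⟩
  -- No joint measurability of `W` is needed: monotone paths make each distribution function
  -- monotone, hence measurable, in `τ`.
  have hanti : Antitone fun τ : ℝ => P {ω | W τ.toNNReal ω ≤ t} := by
    intro σ τ hστ
    refine measure_mono_ae ?_
    filter_upwards [hW.mono] with ω hm h
    exact (hm (Real.toNNReal_le_toNNReal hστ)).trans h
  convert hanti.measurable using 2 with τ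
  rw [Measure.map_apply (hW.measurable _) measurableSet_Iic]
  rfl

theorem IsSubordinator.laplace_exponentialTimeLaw (hW : IsSubordinator P W φ) {lam s : ℝ}
    (hlam : 0 < lam) (hs : 0 ≤ s) (hψ : 0 ≤ laplaceExponent φ s) :
    ∫⁻ x, ENNReal.ofReal (Real.exp (-(s * x))) ∂(exponentialTimeLaw P W lam) =
      ENNReal.ofReal (lam / (lam + laplaceExponent φ s)) := by
  have hmm := hW.measurable_map
  have hme : Measurable fun x : ℝ => ENNReal.ofReal (Real.exp (-(s * x))) := by fun_prop
  have hmL : Measurable fun τ : ℝ =>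
      ∫⁻ x, ENNReal.ofReal (Real.exp (-(s * x))) ∂(P.map (W τ.toNNReal)) :=
    (Measure.measurable_lintegral hme).comp hmm
  rw [exponentialTimeLaw, Measure.lintegral_bind hmm.aemeasurable hme.aemeasurable,
    lintegral_withDensity_eq_lintegral_mul _ (by fun_prop) hmL]
  have : ∀ τ ∈ Ioi (0 : ℝ), ((fun τ => ENNReal.ofReal (lam * Real.exp (-(lam * τ)))) *
      fun τ : ℝ => ∫⁻ x, ENNReal.ofReal (Real.exp (-(s * x))) ∂(P.map (W τ.toNNReal))) τ =
      ENNReal.ofReal lam *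
        ENNReal.ofReal (Real.exp (-((lam + laplaceExponent φ s) * τ))) := by
    intro τ hτ
    simp only [Pi.mul_apply]
    rw [lintegral_map hme (hW.measurable _), hW.lintegral_exp _ hs,
      Real.coe_toNNReal _ (le_of_lt hτ), ENNReal.ofReal_mul hlam.le, mul_assoc,
      ← ENNReal.ofReal_mul (Real.exp_nonneg _), ← Real.exp_add]
    congr 3
    ring
  rw [setLIntegral_congr_fun measurableSet_Ioi this, lintegral_const_mul _ (by fun_prop),
    lintegral_Ioi_exp (by linarith), ← ENNReal.ofReal_mul hlam.le, div_eq_mul_inv]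

/-- The Laplace transform of the inverse process is the survival function of the subordinator at an
independent exponential time. -/
theorem IsSubordinator.laplaceInverse_eq (hW : IsSubordinator P W φ)
    (hψ : 0 < laplaceExponent φ 1) {lam : ℝ} (hlam : 0 < lam) (t : ℝ) :
    laplaceInverse P W t lam = 1 - ((exponentialTimeLaw P W lam) (Iic t)).toReal := by
  have hE : AEMeasurable (inverseProcess W t) P :=
    (hW.nullMeasurable_inverseProcess hψ t).aemeasurable
  have hnn : (P.map (inverseProcess W t)) (Iio 0) = 0 := by
    rw [Measure.map_apply_of_aemeasurable hE measurableSet_Iio]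
    convert measure_empty (μ := P)
    ext ω
    simpa using inverseProcess_nonneg W t ω
  -- This rewrites `E[1 - e^(-λ E_t)]` as `λ ∫ P(E_t > τ) e^(-λτ) dτ`, to which the
  -- almost-everywhere identity for the survival function applies.
  have hL := lintegral_tail_mul_exp _ hnn hlam
  rw [lintegral_map' (by fun_prop) hE] at hL
  have hm : (exponentialTimeLaw P W lam) (Iic t) =
      ∫⁻ ω, ENNReal.ofReal (1 - Real.exp (-(lam * inverseProcess W t ω))) ∂P := by
    have hmL : Measurable fun τ : ℝ => (P.map (W τ.toNNReal)) (Iic t) :=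
      (Measure.measurable_coe measurableSet_Iic).comp hW.measurable_map
    rw [exponentialTimeLaw, Measure.bind_apply measurableSet_Iic hW.measurable_map.aemeasurable,
      lintegral_withDensity_eq_lintegral_mul _ (by fun_prop) hmL]
    have h2 : ∫⁻ ω, ENNReal.ofReal (1 - Real.exp (-(lam * inverseProcess W t ω))) ∂P =
        ENNReal.ofReal lam *
          ∫⁻ ω, ENNReal.ofReal ((1 - Real.exp (-(lam * inverseProcess W t ω))) / lam) ∂P := by
      rw [← lintegral_const_mul' _ _ ENNReal.ofReal_ne_top]
      refine lintegral_congr fun ω => ?_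
      rw [← ENNReal.ofReal_mul hlam.le, mul_div_cancel₀ _ hlam.ne']
    rw [h2, ← hL, ← lintegral_const_mul' _ _ ENNReal.ofReal_ne_top]
    refine lintegral_congr_ae ?_
    filter_upwards [hW.measure_inverseProcess_gt hψ t] with τ hτ
    simp only [Pi.mul_apply]
    rw [Measure.map_apply (hW.measurable _) measurableSet_Iic,
      Measure.map_apply_of_aemeasurable hE measurableSet_Ioi, ENNReal.ofReal_mul hlam.le]
    change _ * P {ω | W τ.toNNReal ω ≤ t} = _ * (P {ω | τ < inverseProcess W t ω} * _)
    rw [hτ]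
    ring
  have hint : Integrable (fun ω => Real.exp (-(lam * inverseProcess W t ω))) P := by
    refine Integrable.of_bound (by fun_prop) 1 (Eventually.of_forall fun ω => ?_)
    rw [Real.norm_eq_abs, Real.abs_exp, Real.exp_le_one_iff]
    have := mul_nonneg hlam.le (inverseProcess_nonneg W t ω)
    linarith
  have hsub : ∫ ω, (1 - Real.exp (-(lam * inverseProcess W t ω))) ∂P =
      1 - laplaceInverse P W t lam := by
    rw [integral_sub (integrable_const _) hint]
    simp [laplaceInverse]
  rw [hm, ← integral_eq_lintegral_of_nonneg_ae, hsub]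
  · ring
  · refine Eventually.of_forall fun ω => ?_
    have := mul_nonneg hlam.le (inverseProcess_nonneg W t ω)
    simpa using this
  · exact aestronglyMeasurable_const.sub hint.aestronglyMeasurable

end Subordinator

/-! ### Lower bounds for `λ + ψ` on the strip `|Im z| ≤ π`. -/

section Spectral

variable {ν : Measure ℝ} [IsFiniteMeasure ν] {b0 b1 : ℝ}

theorem integrable_exp_mul_of_support (hν : ∀ᵐ β ∂ν, β ∈ Icc b0 b1) (x : ℝ) :
    Integrable (fun β => Real.exp (x * β)) ν := by
  refine Integrable.of_bound (by fun_prop) (Real.exp (|x| * max |b0| |b1|)) ?_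
  filter_upwards [hν] with β hβ
  rw [Real.norm_eq_abs, Real.abs_exp, Real.exp_le_exp]
  refine (le_abs_self _).trans ?_
  rw [abs_mul]
  exact mul_le_mul_of_nonneg_left (abs_le_max_abs_abs hβ.1 hβ.2) (abs_nonneg _)

theorem integrable_cexp_mul_of_support (hν : ∀ᵐ β ∂ν, β ∈ Icc b0 b1) (z : ℂ) :
    Integrable (fun β : ℝ => Complex.exp (z * β)) ν := by
  rw [← integrable_norm_iff (by fun_prop)]
  simpa [Complex.norm_exp] using integrable_exp_mul_of_support hν z.re

/-- Compact support makes every exponential moment finite. In logarithmic coordinates `ψ` is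
therefore entire, and the edge of the cut is an ordinary line. -/
theorem differentiable_complexMGF_of_support (hν : ∀ᵐ β ∂ν, β ∈ Icc b0 b1) :
    Differentiable ℂ (complexMGF id ν) := by
  have h : integrableExpSet id ν = univ :=
    eq_univ_of_forall fun x => integrable_exp_mul_of_support hν x
  have := differentiableOn_complexMGF (X := id) (μ := ν)
  rw [h] at this
  simpa [differentiableOn_univ] using this

theorem integrable_exp_mul_sin (hν : ∀ᵐ β ∂ν, β ∈ Icc b0 b1) (x : ℝ) :
    Integrable (fun β => Real.exp (x * β) * Real.sin (β * Real.pi)) ν := by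
  refine (integrable_exp_mul_of_support hν x).mono' (by fun_prop)
    (Eventually.of_forall fun β => ?_)
  rw [norm_mul, Real.norm_eq_abs, Real.abs_exp, Real.norm_eq_abs]
  exact mul_le_of_le_one_right (Real.exp_nonneg _) (Real.abs_sin_le_one _)

theorem sin_mul_pi_nonneg (hb0 : 0 < b0) (hb1 : b1 < 1) {β : ℝ} (hβ : β ∈ Icc b0 b1) :
    0 ≤ Real.sin (β * Real.pi) := by
  have hπ := Real.pi_pos
  refine Real.sin_nonneg_of_nonneg_of_le_pi (mul_nonneg (hb0.le.trans hβ.1) hπ.le) ?_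
  nlinarith [hβ.2]

/-- After a rotation by half the argument, the denominator has a positive real part. -/
theorem le_norm_add_complexMGF (hν : ∀ᵐ β ∂ν, β ∈ Icc b0 b1) (hb0 : 0 < b0) (hb1 : b1 < 1)
    {lam : ℝ} (hlam : 0 ≤ lam) {z : ℂ} (hz : |z.im| ≤ Real.pi) :
    ∫ β, Real.exp (z.re * β) * Real.sin (β * Real.pi) ∂ν ≤ ‖(lam : ℂ) + complexMGF id ν z‖ := by
  set θ : ℝ := -(z.im / 2) with hθ
  have hrot : ‖Complex.exp (θ * Complex.I)‖ = 1 := Complex.norm_exp_ofReal_mul_I θ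
  have hre : (Complex.exp (θ * Complex.I) * ((lam : ℂ) + complexMGF id ν z)).re =
      lam * Real.cos θ + ∫ β, Real.exp (z.re * β) * Real.cos (z.im * β + θ) ∂ν := by
    rw [mul_add, Complex.add_re]
    congr 1
    · rw [mul_comm, Complex.re_ofReal_mul, Complex.exp_ofReal_mul_I_re]
    · rw [complexMGF, ← integral_const_mul, ← RCLike.re_eq_complex_re, ← integral_re]
      · refine integral_congr_ae (Eventually.of_forall fun β => ?_)
        simp only [id, RCLike.re_eq_complex_re]
        rw [← Complex.exp_add, Complex.exp_re]
        simp [add_comm]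
      · exact (integrable_cexp_mul_of_support hν z).const_mul _
  have hπ := Real.pi_pos
  obtain ⟨hz1, hz2⟩ := abs_le.1 hz
  have hcos : 0 ≤ Real.cos θ :=
    Real.cos_nonneg_of_neg_pi_div_two_le_of_le (by linarith) (by linarith)
  have hmono : ∫ β, Real.exp (z.re * β) * Real.sin (β * Real.pi) ∂ν ≤
      ∫ β, Real.exp (z.re * β) * Real.cos (z.im * β + θ) ∂ν := by
    refine integral_mono_ae (integrable_exp_mul_sin hν _) ?_ ?_
    · refine (integrable_exp_mul_of_support hν z.re).mono' (by fun_prop)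
        (Eventually.of_forall fun β => ?_)
      rw [norm_mul, Real.norm_eq_abs, Real.abs_exp, Real.norm_eq_abs]
      exact mul_le_of_le_one_right (Real.exp_nonneg _) (Real.abs_cos_le_one _)
    · filter_upwards [hν] with β hβ
      refine mul_le_mul_of_nonneg_left ?_ (Real.exp_nonneg _)
      have h1 : z.im * β + θ = z.im * (β - 1 / 2) := by rw [hθ]; ring
      -- After the rotation the phase is `Im z (β - 1/2)`. Cosine decreases on `[0, π]`, so the
      -- worst case is `|Im z| = π`, where the cosine is `sin(βπ)`.
      have h2 : Real.sin (β * Real.pi) = Real.cos (|β - 1 / 2| * Real.pi) := by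
        rcases le_total 0 (β - 1 / 2) with h | h
        · rw [abs_of_nonneg h, ← Real.cos_sub_pi_div_two]
          congr 1; ring
        · rw [abs_of_nonpos h, ← Real.cos_pi_div_two_sub]
          congr 1; ring
      rw [h1, h2, ← Real.cos_abs (z.im * _), abs_mul, mul_comm |z.im|]
      have habs : |β - 1 / 2| ≤ 1 := by
        rw [abs_le]; constructor <;> linarith [hβ.1, hβ.2]
      refine Real.cos_le_cos_of_nonneg_of_le_pi (by positivity) ?_ ?_
      · nlinarith
      · exact mul_le_mul_of_nonneg_left hz (abs_nonneg _)
  calc _ ≤ (Complex.exp (θ * Complex.I) * ((lam : ℂ) + complexMGF id ν z)).re := by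
        rw [hre]; linarith [mul_nonneg hlam hcos]
    _ ≤ ‖Complex.exp (θ * Complex.I) * ((lam : ℂ) + complexMGF id ν z)‖ := Complex.re_le_norm _
    _ = _ := by rw [norm_mul, hrot, one_mul]

/-- The exponent is smallest at the endpoint `b0` of the support; for `x ≤ 0` the endpoint `b1`
takes this role. These two cases produce the two powers in `k`. -/
theorem mul_exp_le_of_nonneg (hν : ∀ᵐ β ∂ν, β ∈ Icc b0 b1) (hb0 : 0 < b0) (hb1 : b1 < 1)
    {x : ℝ} (hx : 0 ≤ x) :
    (∫ β, Real.sin (β * Real.pi) ∂ν) * Real.exp (b0 * x) ≤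
      ∫ β, Real.exp (x * β) * Real.sin (β * Real.pi) ∂ν := by
  rw [← integral_mul_const]
  refine integral_mono_ae ?_ (integrable_exp_mul_sin hν _) ?_
  · simpa using (integrable_exp_mul_sin hν 0).mul_const _
  · filter_upwards [hν] with β hβ
    rw [mul_comm]
    refine mul_le_mul_of_nonneg_right (Real.exp_le_exp.2 ?_) (sin_mul_pi_nonneg hb0 hb1 hβ)
    nlinarith [hβ.1]

theorem mul_exp_le_of_nonpos (hν : ∀ᵐ β ∂ν, β ∈ Icc b0 b1) (hb0 : 0 < b0) (hb1 : b1 < 1)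
    {x : ℝ} (hx : x ≤ 0) :
    (∫ β, Real.sin (β * Real.pi) ∂ν) * Real.exp (b1 * x) ≤
      ∫ β, Real.exp (x * β) * Real.sin (β * Real.pi) ∂ν := by
  rw [← integral_mul_const]
  refine integral_mono_ae ?_ (integrable_exp_mul_sin hν _) ?_
  · simpa using (integrable_exp_mul_sin hν 0).mul_const _
  · filter_upwards [hν] with β hβ
    rw [mul_comm]
    refine mul_le_mul_of_nonneg_right (Real.exp_le_exp.2 ?_) (sin_mul_pi_nonneg hb0 hb1 hβ)
    nlinarith [hβ.2]

/-- The resolvent `z ↦ (λ + ∫ e^(zβ) ν(dβ))⁻¹` in logarithmic coordinates. -/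
def logResolvent (ν : Measure ℝ) (lam : ℝ) (z : ℂ) : ℂ := ((lam : ℂ) + complexMGF id ν z)⁻¹

/-- The boundary value of (minus) the imaginary part of the resolvent on the cut. -/
def logSpectral (ν : Measure ℝ) (lam x : ℝ) : ℝ := -(logResolvent ν lam (x + Real.pi * Complex.I)).im

/-- At `Im z = π` the denominator has imaginary part `∫ e^(xβ) sin(βπ) ν(dβ) ≥ 0`, and inversion
reverses its sign. -/
theorem logSpectral_nonneg (hν : ∀ᵐ β ∂ν, β ∈ Icc b0 b1) (hb0 : 0 < b0)
    (hb1 : b1 < 1) (lam x : ℝ) : 0 ≤ logSpectral ν lam x := by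
  have him : ((lam : ℂ) + complexMGF id ν (x + Real.pi * Complex.I)).im =
      ∫ β, Real.exp (x * β) * Real.sin (β * Real.pi) ∂ν := by
    rw [Complex.add_im, Complex.ofReal_im, zero_add, complexMGF, ← RCLike.im_eq_complex_im]
    simp only [id]
    rw [← integral_im (integrable_cexp_mul_of_support hν _)]
    refine integral_congr_ae (Eventually.of_forall fun β => ?_)
    simp only [RCLike.im_eq_complex_im]
    rw [Complex.exp_im]
    simp [mul_comm]
  rw [logSpectral, logResolvent, Complex.inv_im, him, neg_div, neg_neg]
  refine div_nonneg (integral_nonneg_of_ae ?_) (Complex.normSq_nonneg _)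
  filter_upwards [hν] with β hβ
  exact mul_nonneg (Real.exp_nonneg _) (sin_mul_pi_nonneg hb0 hb1 hβ)

variable (hν : ∀ᵐ β ∂ν, β ∈ Icc b0 b1) (hb0 : 0 < b0) (hb1 : b1 < 1)
  (hS : 0 < ∫ β, Real.sin (β * Real.pi) ∂ν) {lam : ℝ} (hlam : 0 ≤ lam)
include hν hb0 hb1 hS hlam

theorem norm_logResolvent_le_of_nonneg {z : ℂ} (hz : |z.im| ≤ Real.pi) (hx : 0 ≤ z.re) :
    ‖logResolvent ν lam z‖ ≤ (∫ β, Real.sin (β * Real.pi) ∂ν)⁻¹ * Real.exp (-(b0 * z.re)) := by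
  rw [logResolvent, norm_inv, Real.exp_neg, ← mul_inv]
  exact inv_anti₀ (by positivity) ((mul_exp_le_of_nonneg hν hb0 hb1 hx).trans
    (le_norm_add_complexMGF hν hb0 hb1 hlam hz))

theorem norm_logResolvent_le_of_nonpos {z : ℂ} (hz : |z.im| ≤ Real.pi) (hx : z.re ≤ 0) :
    ‖logResolvent ν lam z‖ ≤ (∫ β, Real.sin (β * Real.pi) ∂ν)⁻¹ * Real.exp (-(b1 * z.re)) := by
  rw [logResolvent, norm_inv, Real.exp_neg, ← mul_inv]
  exact inv_anti₀ (by positivity) ((mul_exp_le_of_nonpos hν hb0 hb1 hx).trans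
    (le_norm_add_complexMGF hν hb0 hb1 hlam hz))

theorem add_complexMGF_ne_zero {z : ℂ} (hz : |z.im| ≤ Real.pi) :
    (lam : ℂ) + complexMGF id ν z ≠ 0 := by
  have h := le_norm_add_complexMGF hν hb0 hb1 hlam hz
  rw [← norm_pos_iff]
  refine lt_of_lt_of_le ?_ h
  rcases le_total 0 z.re with hx | hx
  · exact lt_of_lt_of_le (by positivity) (mul_exp_le_of_nonneg hν hb0 hb1 hx)
  · exact lt_of_lt_of_le (by positivity) (mul_exp_le_of_nonpos hν hb0 hb1 hx)

theorem logSpectral_le (x : ℝ) :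
    logSpectral ν lam x ≤ (∫ β, Real.sin (β * Real.pi) ∂ν)⁻¹ *
      (Real.exp (-(b1 * x)) + Real.exp (-(b0 * x))) := by
  have him : |((x : ℂ) + Real.pi * Complex.I).im| ≤ Real.pi := by
    simp [abs_of_pos Real.pi_pos]
  have hre : ((x : ℂ) + Real.pi * Complex.I).re = x := by simp
  have h1 : logSpectral ν lam x ≤ ‖logResolvent ν lam (x + Real.pi * Complex.I)‖ :=
    (neg_le_abs _).trans (Complex.abs_im_le_norm _)
  refine h1.trans ?_
  rw [mul_add]
  rcases le_total 0 x with hx | hx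
  · have := norm_logResolvent_le_of_nonneg hν hb0 hb1 hS hlam him (hre.symm ▸ hx)
    rw [hre] at this
    exact this.trans (le_add_of_nonneg_left (by positivity))
  · have := norm_logResolvent_le_of_nonpos hν hb0 hb1 hS hlam him (hre.symm ▸ hx)
    rw [hre] at this
    exact this.trans (le_add_of_nonneg_right (by positivity))

theorem differentiableAt_logResolvent {z : ℂ} (hz : |z.im| ≤ Real.pi) :
    DifferentiableAt ℂ (logResolvent ν lam) z :=
  (((differentiable_complexMGF_of_support hν) z).const_add _).inv
    (add_complexMGF_ne_zero hν hb0 hb1 hS hlam hz)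

theorem continuous_logSpectral : Continuous (logSpectral ν lam) := by
  refine (Complex.continuous_im.comp ?_).neg
  rw [continuous_iff_continuousAt]
  intro x
  have him : |((x : ℂ) + Real.pi * Complex.I).im| ≤ Real.pi := by
    simp [abs_of_pos Real.pi_pos]
  exact ContinuousAt.comp (f := fun x : ℝ => (x : ℂ) + Real.pi * Complex.I)
    (differentiableAt_logResolvent hν hb0 hb1 hS hlam him).continuousAt (by fun_prop)

end Spectral

/-! ### Contour integration in the half strip `0 ≤ Im z ≤ π`. -/

/-- The Cauchy kernel of the resolvent in logarithmic coordinates, with the pole removed. -/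
def logCauchyKernel (ν : Measure ℝ) (lam : ℝ) (a z : ℂ) : ℂ :=
  dslope (logResolvent ν lam) a z / dslope Complex.exp a z * Complex.exp z

theorem logCauchyKernel_of_ne (ν : Measure ℝ) (lam : ℝ) {a z : ℂ} (h : z ≠ a) :
    logCauchyKernel ν lam a z = (logResolvent ν lam z - logResolvent ν lam a) /
      (Complex.exp z - Complex.exp a) * Complex.exp z := by
  rw [logCauchyKernel, dslope_of_ne _ h, dslope_of_ne _ h, slope_def_field, slope_def_field,
    div_div_div_cancel_right₀ (sub_ne_zero.2 h)]

/-- The exponential is injective on `-π < Im z ≤ π`, so `e^z - e^x` vanishes there only at `z = x`,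
and to first order. -/
theorem dslope_exp_ne_zero {x : ℝ} {z : ℂ} (hz : z.im ∈ Icc 0 Real.pi) :
    dslope Complex.exp x z ≠ 0 := by
  by_cases h : z = x
  · rw [h, dslope_same, Complex.deriv_exp]
    exact Complex.exp_ne_zero _
  · rw [dslope_of_ne _ h, slope_def_field]
    refine div_ne_zero (fun h0 => h ?_) (sub_ne_zero.2 h)
    refine Complex.exp_inj_of_neg_pi_lt_of_le_pi ?_ hz.2 ?_ ?_ (sub_eq_zero.1 h0)
    · linarith [hz.1, Real.pi_pos]
    · simp [Real.pi_pos]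
    · simp [Real.pi_pos.le]

theorem logResolvent_ofReal_im (ν : Measure ℝ) (lam x : ℝ) : (logResolvent ν lam x).im = 0 := by
  rw [logResolvent, complexMGF_ofReal, ← Complex.ofReal_add, ← Complex.ofReal_inv,
    Complex.ofReal_im]

section Cauchy

variable {ν : Measure ℝ} [IsFiniteMeasure ν] {b0 b1 : ℝ}
  (hν : ∀ᵐ β ∂ν, β ∈ Icc b0 b1) (hb0 : 0 < b0) (hb1 : b1 < 1)
  (hS : 0 < ∫ β, Real.sin (β * Real.pi) ∂ν) {lam : ℝ} (hlam : 0 ≤ lam)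
include hν hb0 hb1 hS hlam

theorem differentiableAt_logCauchyKernel (x : ℝ) {z : ℂ} (hz : z.im ∈ Icc 0 Real.pi) :
    DifferentiableAt ℂ (logCauchyKernel ν lam x) z := by
  have hopen : IsOpen {z : ℂ | (lam : ℂ) + complexMGF id ν z ≠ 0} :=
    isOpen_ne.preimage ((differentiable_complexMGF_of_support hν).continuous.const_add _)
  have hF : DifferentiableOn ℂ (logResolvent ν lam) {z : ℂ | (lam : ℂ) + complexMGF id ν z ≠ 0} :=
    fun z hz => ((((differentiable_complexMGF_of_support hν) z).const_add _).inv
      hz).differentiableWithinAt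
  have hx : |((x : ℂ)).im| ≤ Real.pi := by simp [Real.pi_pos.le]
  have hz' : |z.im| ≤ Real.pi := by rw [abs_of_nonneg hz.1]; exact hz.2
  have h1 := ((Complex.differentiableOn_dslope (hopen.mem_nhds
    (add_complexMGF_ne_zero hν hb0 hb1 hS hlam hx))).2 hF).differentiableAt
    (hopen.mem_nhds (add_complexMGF_ne_zero hν hb0 hb1 hS hlam hz'))
  have h2 : DifferentiableAt ℂ (dslope Complex.exp (x : ℂ)) z :=
    ((Complex.differentiableOn_dslope (univ_mem (f := 𝓝 (x : ℂ)))).2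
      Complex.differentiable_exp.differentiableOn).differentiableAt univ_mem
  exact (h1.div h2 (dslope_exp_ne_zero hz)).mul Complex.differentiable_exp.differentiableAt

theorem continuous_logCauchyKernel_comp (x : ℝ) {γ : ℝ → ℂ} {S : Set ℝ} (hγ : Continuous γ)
    (him : ∀ y ∈ S, (γ y).im ∈ Icc 0 Real.pi) :
    ContinuousOn (fun y => logCauchyKernel ν lam x (γ y)) S := fun y hy =>
  (ContinuousAt.comp (f := γ) (differentiableAt_logCauchyKernel hν hb0 hb1 hS hlam x
    (him y hy)).continuousAt hγ.continuousAt).continuousWithinAt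

/-- Far to the right `logResolvent` decays like `e^(-b0 R)` while `e^z/(e^z - e^x)` tends to `1`, so
the kernel converges uniformly to the negative of the resolvent at `x`. This side supplies the main
term. -/
theorem tendsto_logCauchyKernel_atTop (x : ℝ) :
    Tendsto (fun R : ℝ => ∫ y in (0 : ℝ)..Real.pi, logCauchyKernel ν lam x (R + y * Complex.I))
      atTop (𝓝 (-(Real.pi * logResolvent ν lam x))) := by
  set A := (∫ β, Real.sin (β * Real.pi) ∂ν)⁻¹ with hA
  set K := ‖logResolvent ν lam x‖ with hK
  set g : ℝ → ℝ := fun R => (A * Real.exp (-(b0 * R)) + K * Real.exp (x - R)) /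
    (1 - Real.exp (x - R)) with hg
  have hexp0 : Tendsto (fun R : ℝ => Real.exp (x - R)) atTop (𝓝 0) :=
    Real.tendsto_exp_atBot.comp (tendsto_atBot_add_const_left _ x tendsto_neg_atTop_atBot)
  have hg0 : Tendsto g atTop (𝓝 0) := by
    have h1 : Tendsto (fun R : ℝ => Real.exp (-(b0 * R))) atTop (𝓝 0) :=
      Real.tendsto_exp_atBot.comp
        (tendsto_neg_atTop_atBot.comp (tendsto_id.const_mul_atTop hb0))
    have : Tendsto g atTop (𝓝 ((A * 0 + K * 0) / (1 - 0))) :=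
      ((h1.const_mul A).add (hexp0.const_mul K)).div (hexp0.const_sub 1) (by simp)
    simpa using this
  rw [tendsto_iff_norm_sub_tendsto_zero]
  refine squeeze_zero' (Eventually.of_forall fun _ => norm_nonneg _) ?_
    (by simpa only [zero_mul] using hg0.mul_const |Real.pi - 0|)
  filter_upwards [eventually_gt_atTop x, eventually_ge_atTop 0] with R hR hR0
  have hpos : 0 < 1 - Real.exp (x - R) := by
    rw [sub_pos, Real.exp_lt_one_iff]; linarith
  have him : ∀ y ∈ uIcc 0 Real.pi, ((R : ℂ) + y * Complex.I).im ∈ Icc 0 Real.pi := by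
    intro y hy
    rw [uIcc_of_le Real.pi_pos.le] at hy
    simpa using hy
  have hint : IntervalIntegrable
      (fun y : ℝ => logCauchyKernel ν lam x (R + y * Complex.I)) volume 0 Real.pi :=
    (continuous_logCauchyKernel_comp hν hb0 hb1 hS hlam x (by fun_prop) him).intervalIntegrable
  have hc : (Real.pi * logResolvent ν lam x : ℂ) =
      ∫ _ in (0 : ℝ)..Real.pi, logResolvent ν lam x := by simp
  rw [sub_neg_eq_add, hc, ← intervalIntegral.integral_add hint (by simp)]
  refine intervalIntegral.norm_integral_le_of_norm_le_const fun y hy => ?_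
  set z : ℂ := (R : ℂ) + y * Complex.I with hz
  have hzre : z.re = R := by simp [hz]
  have hzim : z.im = y := by simp [hz]
  rw [uIoc_of_le Real.pi_pos.le] at hy
  have hne : z ≠ x := by
    intro h
    have : z.re = x := by rw [h]; simp
    linarith
  have hF := norm_logResolvent_le_of_nonneg hν hb0 hb1 hS hlam (z := z)
    (by rw [hzim, abs_of_pos hy.1]; exact hy.2) (by rw [hzre]; exact hR0)
  rw [hzre] at hF
  have hn : ‖Complex.exp (x - z)‖ = Real.exp (x - R) := by
    rw [Complex.norm_exp]; simp [hzre]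
  have hden : 1 - Real.exp (x - R) ≤ ‖1 - Complex.exp (x - z)‖ := by
    have := norm_sub_norm_le (1 : ℂ) (Complex.exp (x - z))
    rwa [norm_one, hn] at this
  have hden0 : (1 : ℂ) - Complex.exp (x - z) ≠ 0 := by
    rw [← norm_pos_iff]; linarith
  have heq : logCauchyKernel ν lam x z + logResolvent ν lam x =
      (logResolvent ν lam z - logResolvent ν lam x * Complex.exp (x - z)) /
        (1 - Complex.exp (x - z)) := by
    have he : Complex.exp (x : ℂ) = Complex.exp (x - z) * Complex.exp z := by
      rw [← Complex.exp_add]; ring_nf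
    have hez := Complex.exp_ne_zero z
    rw [logCauchyKernel_of_ne _ _ hne, he, eq_div_iff hden0,
      show Complex.exp z - Complex.exp (x - z) * Complex.exp z =
        (1 - Complex.exp (x - z)) * Complex.exp z by ring]
    field_simp
    ring
  rw [heq, norm_div, hg]
  refine div_le_div₀ ?_ ?_ hpos hden
  · have : 0 ≤ A := (inv_pos.2 hS).le
    positivity
  · refine (norm_sub_le _ _).trans (add_le_add hF ?_)
    rw [norm_mul, hn]

/-- Far to the left the resolvent may grow like `e^(b1 R)`, but the factor `e^z` contributes
`e^(-R)`, which wins because `b1 < 1`. -/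
theorem tendsto_logCauchyKernel_atBot (x : ℝ) :
    Tendsto (fun R : ℝ => ∫ y in (0 : ℝ)..Real.pi,
      logCauchyKernel ν lam x ((-R : ℝ) + y * Complex.I)) atTop (𝓝 0) := by
  set A := (∫ β, Real.sin (β * Real.pi) ∂ν)⁻¹ with hA
  set K := ‖logResolvent ν lam x‖ with hK
  set g : ℝ → ℝ := fun R => (A * Real.exp (-((1 - b1) * R)) + K * Real.exp (-R)) /
    (Real.exp x - Real.exp (-R)) with hg
  have hexp0 : Tendsto (fun R : ℝ => Real.exp (-R)) atTop (𝓝 0) :=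
    Real.tendsto_exp_atBot.comp tendsto_neg_atTop_atBot
  have hg0 : Tendsto g atTop (𝓝 0) := by
    have h1 : Tendsto (fun R : ℝ => Real.exp (-((1 - b1) * R))) atTop (𝓝 0) :=
      Real.tendsto_exp_atBot.comp
        (tendsto_neg_atTop_atBot.comp (tendsto_id.const_mul_atTop (by linarith)))
    have : Tendsto g atTop (𝓝 ((A * 0 + K * 0) / (Real.exp x - 0))) :=
      ((h1.const_mul A).add (hexp0.const_mul K)).div (hexp0.const_sub (Real.exp x))
      (by simp [Real.exp_ne_zero])
    simpa using this
  refine squeeze_zero_norm' ?_ (by simpa only [zero_mul] using hg0.mul_const |Real.pi - 0|)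
  filter_upwards [eventually_gt_atTop (-x), eventually_ge_atTop 0] with R hR hR0
  have hpos : 0 < Real.exp x - Real.exp (-R) := by
    rw [sub_pos, Real.exp_lt_exp]; linarith
  refine intervalIntegral.norm_integral_le_of_norm_le_const fun y hy => ?_
  set z : ℂ := ((-R : ℝ) : ℂ) + y * Complex.I with hz
  have hzre : z.re = -R := by simp [hz]
  have hzim : z.im = y := by simp [hz]
  rw [uIoc_of_le Real.pi_pos.le] at hy
  have hne : z ≠ x := by
    intro h
    have : z.re = x := by rw [h]; simp
    linarith
  have hF := norm_logResolvent_le_of_nonpos hν hb0 hb1 hS hlam (z := z)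
    (by rw [hzim, abs_of_pos hy.1]; exact hy.2) (by rw [hzre]; linarith)
  rw [hzre] at hF
  have hn : ‖Complex.exp z‖ = Real.exp (-R) := by
    rw [Complex.norm_exp, hzre]
  have hnx : ‖Complex.exp (x : ℂ)‖ = Real.exp x := by
    rw [Complex.norm_exp, Complex.ofReal_re]
  have hden : Real.exp x - Real.exp (-R) ≤ ‖Complex.exp z - Complex.exp x‖ := by
    have := norm_sub_norm_le (Complex.exp (x : ℂ)) (Complex.exp z)
    rwa [hn, hnx, norm_sub_rev] at this
  rw [logCauchyKernel_of_ne _ _ hne, div_mul_eq_mul_div, norm_div, hg]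
  refine div_le_div₀ ?_ ?_ hpos hden
  · have : 0 ≤ A := (inv_pos.2 hS).le
    positivity
  · rw [norm_mul, hn]
    calc _ ≤ (A * Real.exp (-(b1 * -R)) + K) * Real.exp (-R) := by
          gcongr
          exact (norm_sub_le _ _).trans (add_le_add hF le_rfl)
      _ = _ := by
          rw [add_mul, mul_assoc, ← Real.exp_add]
          ring_nf

/-- Imaginary part of Cauchy's theorem on the rectangle with vertices `-R`, `R`, `R + πi`, `-R +
πi`. The resolvent is real on the real axis, so the bottom side drops out and the upper half of the
cut plane suffices. -/
theorem tendsto_integral_logSpectral (x : ℝ) :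
    Tendsto (fun R : ℝ => ∫ y in -R..R,
      logSpectral ν lam y * (Real.exp y / (Real.exp y + Real.exp x))) atTop
      (𝓝 (Real.pi * (logResolvent ν lam x).re)) := by
  have h1 := Complex.continuous_re.continuousAt.tendsto.comp
    (tendsto_logCauchyKernel_atTop hν hb0 hb1 hS hlam x)
  have h2 := Complex.continuous_re.continuousAt.tendsto.comp
    (tendsto_logCauchyKernel_atBot hν hb0 hb1 hS hlam x)
  have h3 := h2.sub h1
  have hlimit : (0 : ℂ).re - (-(Real.pi * logResolvent ν lam x)).re =
      Real.pi * (logResolvent ν lam x).re := by simp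
  rw [hlimit] at h3
  refine h3.congr' ?_
  filter_upwards [eventually_ge_atTop 0] with R hR
  have hrect := Complex.integral_boundary_rect_eq_zero_of_differentiableOn
    (logCauchyKernel ν lam x) ((-R : ℝ) : ℂ) ((R : ℂ) + Real.pi * Complex.I) (by
      intro z hz
      refine (differentiableAt_logCauchyKernel hν hb0 hb1 hS hlam x ?_).differentiableWithinAt
      have := hz.2
      simpa [uIcc_of_le Real.pi_pos.le] using this)
  simp only [Complex.ofReal_im, Complex.ofReal_re, Complex.add_re, Complex.mul_re, Complex.I_re,
    Complex.I_im, Complex.add_im, Complex.mul_im, mul_zero, mul_one, zero_mul, sub_zero,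
    add_zero, zero_add, Complex.ofReal_zero, smul_eq_mul] at hrect
  have himag := congrArg Complex.im hrect
  rw [Complex.sub_im, Complex.add_im, Complex.sub_im, Complex.I_mul_im, Complex.I_mul_im,
    Complex.zero_im] at himag
  have him : ∀ {u v : ℝ} (γ : ℝ → ℂ), Continuous γ → (∀ y, (γ y).im ∈ Icc 0 Real.pi) →
      (∫ y in u..v, logCauchyKernel ν lam x (γ y)).im =
        ∫ y in u..v, (logCauchyKernel ν lam x (γ y)).im := by
    intro u v γ hγ hγi
    have := Complex.imCLM.intervalIntegral_comp_comm
      ((continuous_logCauchyKernel_comp hν hb0 hb1 hS hlam x (S := uIcc u v) hγ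
        fun y _ => hγi y).intervalIntegrable (μ := volume))
    exact this.symm
  have hbot : (∫ y in -R..R, logCauchyKernel ν lam x (y : ℂ)).im = 0 := by
    rw [him _ Complex.continuous_ofReal (fun y => by simp [Real.pi_pos.le])]
    rw [← intervalIntegral.integral_zero (a := -R) (b := R) (μ := volume)]
    refine intervalIntegral.integral_congr_ae ?_
    -- At `y = x` the kernel is given by derivatives rather than by the quotient; this single point
    -- is negligible.
    filter_upwards [(countable_singleton x).ae_notMem volume] with y hy _
    have hne : (y : ℂ) ≠ x := by simpa using hy
    rw [logCauchyKernel_of_ne _ _ hne]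
    have hr : ∀ y : ℝ, logResolvent ν lam y = ((logResolvent ν lam y).re : ℂ) := fun y =>
      Complex.ext (by simp) (by simp [logResolvent_ofReal_im])
    rw [hr y, hr x, ← Complex.ofReal_exp, ← Complex.ofReal_exp, ← Complex.ofReal_sub,
      ← Complex.ofReal_sub, ← Complex.ofReal_div, ← Complex.ofReal_mul, Complex.ofReal_im]
  have htop : (∫ y in -R..R, logCauchyKernel ν lam x (y + Real.pi * Complex.I)).im =
      -∫ y in -R..R, logSpectral ν lam y * (Real.exp y / (Real.exp y + Real.exp x)) := by
    rw [him (fun y : ℝ => (y : ℂ) + Real.pi * Complex.I) (by fun_prop)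
      (fun y => by simp [Real.pi_pos.le]), ← intervalIntegral.integral_neg]
    refine intervalIntegral.integral_congr fun y _ => ?_
    have hne : (y : ℂ) + Real.pi * Complex.I ≠ x := by
      intro h
      have := congrArg Complex.im h
      simp [Real.pi_ne_zero] at this
    rw [logCauchyKernel_of_ne _ _ hne, Complex.exp_add, Complex.exp_pi_mul_I,
      show (logResolvent ν lam (y + Real.pi * Complex.I) - logResolvent ν lam x) /
        (Complex.exp y * -1 - Complex.exp x) * (Complex.exp y * -1) =
        ((Real.exp y / (Real.exp y + Real.exp x) : ℝ) : ℂ) *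
        (logResolvent ν lam (y + Real.pi * Complex.I) - logResolvent ν lam x) by
        push_cast
        rw [show Complex.exp y * -1 - Complex.exp x = -(Complex.exp y + Complex.exp x) by ring,
          div_neg]
        ring,
      Complex.im_ofReal_mul, Complex.sub_im, logResolvent_ofReal_im, logSpectral]
    ring
  rw [hbot, htop] at himag
  simp only [Function.comp_apply]
  push_cast at himag ⊢
  linarith

theorem lintegral_logSpectral (x : ℝ) :
    ∫⁻ y, ENNReal.ofReal (logSpectral ν lam y * (Real.exp y / (Real.exp y + Real.exp x))) =
      ENNReal.ofReal (Real.pi * (logResolvent ν lam x).re) := by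
  have hcont : Continuous fun y : ℝ =>
      logSpectral ν lam y * (Real.exp y / (Real.exp y + Real.exp x)) :=
    (continuous_logSpectral hν hb0 hb1 hS hlam).mul
      (Real.continuous_exp.div (by fun_prop) fun y => by positivity)
  have hnn : ∀ y : ℝ, 0 ≤ logSpectral ν lam y * (Real.exp y / (Real.exp y + Real.exp x)) :=
    fun y => mul_nonneg (logSpectral_nonneg hν hb0 hb1 lam y) (by positivity)
  have ht := tendsto_integral_logSpectral hν hb0 hb1 hS hlam x
  -- Nonnegativity upgrades convergence of the symmetric truncations to integrability on the whole
  -- line.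
  have hint := integrable_of_intervalIntegral_norm_tendsto (μ := volume) (l := atTop)
    (a := fun R : ℝ => -R) (b := id) _
    (fun R => hcont.integrableOn_Ioc) tendsto_neg_atTop_atBot tendsto_id
    (ht.congr fun R => by simp only [Real.norm_eq_abs, abs_of_nonneg (hnn _), id])
  have hval := tendsto_nhds_unique
    (intervalIntegral_tendsto_integral hint tendsto_neg_atTop_atBot tendsto_id) ht
  rw [← hval, ofReal_integral_eq_lintegral_ofReal hint (Eventually.of_forall hnn)]

end Cauchy

/-! ### Continuity of Laplace transforms and causal convolutions. -/

/-- A Laplace transform is continuous where it is finite. -/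
theorem continuousOn_laplace {m : Measure ℝ} {U : Set ℝ} (hU : IsOpen U)
    (hfin : ∀ t ∈ U, ∫⁻ x, ENNReal.ofReal (Real.exp (-(t * x))) ∂m ≠ ∞) :
    ContinuousOn (fun t => ∫⁻ x, ENNReal.ofReal (Real.exp (-(t * x))) ∂m) U := by
  intro t ht
  obtain ⟨a, c, ⟨hat, htc⟩, hac⟩ :=
    (mem_nhds_iff_exists_Ioo_subset).1 (hU.mem_nhds ht)
  obtain ⟨a', ha', hat'⟩ := exists_between hat
  obtain ⟨c', htc', hc'⟩ := exists_between htc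
  have hma := hfin a' (hac ⟨ha', hat'.trans htc⟩)
  have hmc := hfin c' (hac ⟨hat.trans htc', hc'⟩)
  refine ContinuousAt.continuousWithinAt ?_
  -- For `a' < s < c'`, `e^(-sx)` is at most `e^(-a'x)` when `x ≥ 0` and at most `e^(-c'x)` when `x
  -- ≤ 0`.
  refine tendsto_lintegral_filter_of_dominated_convergence
    (fun x => ENNReal.ofReal (Real.exp (-(a' * x))) + ENNReal.ofReal (Real.exp (-(c' * x))))
    (Eventually.of_forall fun _ => by fun_prop) ?_ ?_ ?_
  · filter_upwards [Ioo_mem_nhds hat' htc'] with s hs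
    refine Eventually.of_forall fun x => ?_
    rcases le_total 0 x with hx | hx
    · refine le_add_of_le_of_nonneg (ENNReal.ofReal_le_ofReal (Real.exp_le_exp.2 ?_)) zero_le
      nlinarith [hs.1]
    · refine le_add_of_nonneg_of_le zero_le (ENNReal.ofReal_le_ofReal (Real.exp_le_exp.2 ?_))
      nlinarith [hs.2]
  · rw [lintegral_add_left (by fun_prop)]
    exact ENNReal.add_ne_top.2 ⟨hma, hmc⟩
  · refine Eventually.of_forall fun x => ?_
    exact (ENNReal.continuous_ofReal.comp (by fun_prop :
      Continuous fun s : ℝ => Real.exp (-(s * x)))).tendsto t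

section Convolution

/-- The convolution over `(0, t)`. -/
def causalConv (f κ : ℝ → ℝ≥0∞) (t : ℝ) : ℝ≥0∞ := ∫⁻ r in Ioo 0 t, f r * κ (t - r)

theorem causalConv_eq_indicator (f κ : ℝ → ℝ≥0∞) (t : ℝ) :
    causalConv f κ t = ∫⁻ r, (Ioi 0).indicator f r * (Ioi 0).indicator κ (t - r) := by
  rw [causalConv, ← lintegral_indicator measurableSet_Ioo]
  refine lintegral_congr fun r => ?_
  by_cases h1 : 0 < r <;> by_cases h2 : r < t <;> simp [indicator, h1, h2]

theorem measurable_causalConv {f κ : ℝ → ℝ≥0∞} (hf : Measurable f) (hκ : Measurable κ) :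
    Measurable (causalConv f κ) := by
  have hf' : Measurable ((Ioi 0).indicator f) := hf.indicator measurableSet_Ioi
  have hκ' : Measurable ((Ioi 0).indicator κ) := hκ.indicator measurableSet_Ioi
  rw [show causalConv f κ = _ from funext (causalConv_eq_indicator f κ)]
  exact Measurable.lintegral_prod_right'
    (f := fun q : ℝ × ℝ => (Ioi 0).indicator f q.2 * (Ioi 0).indicator κ (q.1 - q.2))
    ((hf'.comp measurable_snd).mul (hκ'.comp (measurable_fst.sub measurable_snd)))

theorem laplace_causalConv {f κ : ℝ → ℝ≥0∞} (hf : Measurable f) (hκ : Measurable κ) (s : ℝ) :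
    ∫⁻ t in Ioi (0 : ℝ), causalConv f κ t * ENNReal.ofReal (Real.exp (-(s * t))) =
      (∫⁻ t in Ioi (0 : ℝ), f t * ENNReal.ofReal (Real.exp (-(s * t)))) *
        ∫⁻ t in Ioi (0 : ℝ), κ t * ENNReal.ofReal (Real.exp (-(s * t))) := by
  have hf' : Measurable ((Ioi 0).indicator f) := hf.indicator measurableSet_Ioi
  have hκ' : Measurable ((Ioi 0).indicator κ) := hκ.indicator measurableSet_Ioi
  have ind : ∀ g : ℝ → ℝ≥0∞, ∫⁻ t in Ioi (0 : ℝ), g t * ENNReal.ofReal (Real.exp (-(s * t))) =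
      ∫⁻ t, (Ioi 0).indicator g t * ENNReal.ofReal (Real.exp (-(s * t))) := by
    intro g
    rw [← lintegral_indicator measurableSet_Ioi]
    refine lintegral_congr fun t => ?_
    by_cases h : 0 < t <;> simp [indicator, h]
  have hzero : (Ioi 0).indicator (causalConv f κ) = causalConv f κ := by
    rw [indicator_eq_self]
    intro t ht
    by_contra h
    refine ht ?_
    rw [causalConv, Ioo_eq_empty (by simpa using h), Measure.restrict_empty, lintegral_zero_measure]
  rw [ind, ind, ind, hzero]
  simp_rw [causalConv_eq_indicator]
  calc ∫⁻ t, (∫⁻ r, (Ioi 0).indicator f r * (Ioi 0).indicator κ (t - r)) *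
          ENNReal.ofReal (Real.exp (-(s * t)))
      = ∫⁻ t, ∫⁻ r, (Ioi 0).indicator f r * ENNReal.ofReal (Real.exp (-(s * r))) *
          ((Ioi 0).indicator κ (t - r) * ENNReal.ofReal (Real.exp (-(s * (t - r))))) := by
        refine lintegral_congr fun t => ?_
        rw [← lintegral_mul_const' _ _ ENNReal.ofReal_ne_top]
        refine lintegral_congr fun r => ?_
        rw [mul_mul_mul_comm, ← ENNReal.ofReal_mul (Real.exp_nonneg _), ← Real.exp_add]
        ring_nf
    _ = ∫⁻ r, ∫⁻ t, (Ioi 0).indicator f r * ENNReal.ofReal (Real.exp (-(s * r))) *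
          ((Ioi 0).indicator κ (t - r) * ENNReal.ofReal (Real.exp (-(s * (t - r))))) := by
        refine lintegral_lintegral_swap (Measurable.aemeasurable ?_)
        exact ((hf'.comp measurable_snd).mul (by fun_prop)).mul
          ((hκ'.comp (measurable_fst.sub measurable_snd)).mul (by fun_prop))
    _ = ∫⁻ r, (Ioi 0).indicator f r * ENNReal.ofReal (Real.exp (-(s * r))) *
          ∫⁻ t, (Ioi 0).indicator κ t * ENNReal.ofReal (Real.exp (-(s * t))) := by
        refine lintegral_congr fun r => ?_
        have hmr : Measurable fun t => (Ioi 0).indicator κ (t - r) *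
            ENNReal.ofReal (Real.exp (-(s * (t - r)))) :=
          (hκ'.comp (measurable_id.sub_const r)).mul (by fun_prop)
        rw [lintegral_const_mul _ hmr,
          lintegral_sub_right_eq_self
            (fun t => (Ioi 0).indicator κ t * ENNReal.ofReal (Real.exp (-(s * t))))]
    _ = _ := lintegral_mul_const _ (hf'.mul (by fun_prop))

/-- The substitution `r = tx` moves the dependence on `t` from the domain into the integrand, where
monotonicity can be used. -/
theorem causalConv_eq_scaled (f κ : ℝ → ℝ≥0∞) {t : ℝ} (ht : 0 < t) :
    causalConv f κ t =
      ENNReal.ofReal t * ∫⁻ x in Ioo (0 : ℝ) 1, f (t * x) * κ (t * (1 - x)) := by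
  have himg : (fun x => t * x) '' Ioo (0 : ℝ) 1 = Ioo 0 t := by
    rw [Set.image_mul_left_Ioo ht]; simp
  rw [causalConv, ← himg, lintegral_image_eq_lintegral_abs_deriv_mul measurableSet_Ioo
    (f' := fun _ => t) (fun x _ => by simpa using ((hasDerivAt_id x).const_mul t).hasDerivWithinAt)
    (mul_right_injective₀ ht.ne').injOn, abs_of_pos ht, lintegral_const_mul' _ _ ENNReal.ofReal_ne_top]
  simp_rw [mul_sub, mul_one]

/-- After scaling, the integrand decreases in `t`, so its value at `a` dominates it for all later
times. Finiteness at this one point is thus enough for dominated convergence. -/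
theorem continuousOn_causalConv {f κ : ℝ → ℝ≥0∞} (hf : Measurable f) (hκ : Measurable κ)
    (hfa : AntitoneOn f (Ioi 0)) (hκa : AntitoneOn κ (Ioi 0))
    (hfc : ContinuousOn f (Ioi 0)) (hκc : ContinuousOn κ (Ioi 0))
    (hf_top : ∀ t, 0 < t → f t ≠ ∞) (hκ_top : ∀ t, 0 < t → κ t ≠ ∞)
    {a : ℝ} (ha : 0 < a) (hfin : causalConv f κ a ≠ ∞) :
    ContinuousOn (causalConv f κ) (Ioi a) := by
  rw [causalConv_eq_scaled f κ ha] at hfin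
  have hfin' : ∫⁻ x in Ioo (0 : ℝ) 1, f (a * x) * κ (a * (1 - x)) ≠ ∞ := by
    intro h
    rw [h, ENNReal.mul_top (by simpa using ha)] at hfin
    exact hfin rfl
  have hcont : ContinuousOn (fun t => ∫⁻ x in Ioo (0 : ℝ) 1, f (t * x) * κ (t * (1 - x)))
      (Ioi a) := by
    intro t ht
    have ht0 : 0 < t := ha.trans ht
    refine ContinuousAt.continuousWithinAt ?_
    refine tendsto_lintegral_filter_of_dominated_convergence
      (fun x => f (a * x) * κ (a * (1 - x))) (Eventually.of_forall fun _ => by fun_prop) ?_ hfin' ?_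
    · filter_upwards [Ioi_mem_nhds ht] with u hu
      filter_upwards [ae_restrict_mem measurableSet_Ioo] with x hx
      have hu' : a ≤ u := le_of_lt hu
      have hx1 : 0 < 1 - x := by linarith [hx.2]
      have hu0 : 0 < u := ha.trans hu
      exact mul_le_mul' (hfa (mul_pos ha hx.1) (mul_pos hu0 hx.1)
          (mul_le_mul_of_nonneg_right hu' hx.1.le))
        (hκa (mul_pos ha hx1) (mul_pos hu0 hx1) (mul_le_mul_of_nonneg_right hu' hx1.le))
    · filter_upwards [ae_restrict_mem measurableSet_Ioo] with x hx
      have h1 : 0 < t * x := mul_pos ht0 hx.1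
      have h2 : 0 < t * (1 - x) := mul_pos ht0 (by linarith [hx.2])
      refine ENNReal.Tendsto.mul ?_ (Or.inr (hκ_top _ h2)) ?_ (Or.inr (hf_top _ h1))
      · exact (hfc.continuousAt (Ioi_mem_nhds h1)).tendsto.comp
          ((by fun_prop : Continuous fun u : ℝ => u * x).tendsto t)
      · exact (hκc.continuousAt (Ioi_mem_nhds h2)).tendsto.comp
          ((by fun_prop : Continuous fun u : ℝ => u * (1 - x)).tendsto t)
  have htop : ∀ t ∈ Ioi a, ∫⁻ x in Ioo (0 : ℝ) 1, f (t * x) * κ (t * (1 - x)) ≠ ∞ := by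
    intro t ht
    refine ne_top_of_le_ne_top hfin' (setLIntegral_mono' measurableSet_Ioo fun x hx => ?_)
    have hx1 : 0 < 1 - x := by linarith [hx.2]
    have ht0 : 0 < t := ha.trans ht
    exact mul_le_mul' (hfa (mul_pos ha hx.1) (mul_pos ht0 hx.1)
        (mul_le_mul_of_nonneg_right (le_of_lt ht) hx.1.le))
      (hκa (mul_pos ha hx1) (mul_pos ht0 hx1) (mul_le_mul_of_nonneg_right (le_of_lt ht) hx1.le))
  have hprod : ContinuousOn (fun t => ENNReal.ofReal t *
      ∫⁻ x in Ioo (0 : ℝ) 1, f (t * x) * κ (t * (1 - x))) (Ioi a) := fun t ht =>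
    ENNReal.Tendsto.mul (ENNReal.continuous_ofReal.continuousWithinAt) (Or.inr (htop t ht))
      (hcont t ht) (Or.inr ENNReal.ofReal_ne_top)
  exact hprod.congr fun t ht => causalConv_eq_scaled f κ (ha.trans ht)

end Convolution

/-! ### The resolvent kernel and its bound. -/

/-- The density of the spectral measure of the relaxation function. -/
def spectralDensity (ν : Measure ℝ) (lam r : ℝ) : ℝ := Real.pi⁻¹ * logSpectral ν lam (Real.log r)

/-- The inverse Laplace transform of `s ↦ (λ + ∫ s ^ β ν(dβ))⁻¹`. -/
def resolventKernel (ν : Measure ℝ) (lam t : ℝ) : ℝ≥0∞ :=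
  ∫⁻ r in Ioi (0 : ℝ), ENNReal.ofReal (spectralDensity ν lam r) *
    ENNReal.ofReal (Real.exp (-(t * r)))

theorem antitone_resolventKernel (ν : Measure ℝ) (lam : ℝ) : Antitone (resolventKernel ν lam) := by
  intro t u htu
  refine setLIntegral_mono' measurableSet_Ioi fun r hr => ?_
  gcongr
  exact le_of_lt hr

theorem measurable_resolventKernel (ν : Measure ℝ) (lam : ℝ) :
    Measurable (resolventKernel ν lam) :=
  (antitone_resolventKernel ν lam).measurable

section Kernel

variable {ν : Measure ℝ} [IsFiniteMeasure ν] {b0 b1 : ℝ}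

theorem logResolvent_log (ν : Measure ℝ) (lam : ℝ) {s : ℝ} (hs : 0 < s) :
    logResolvent ν lam (Real.log s) = ((lam + ∫ β, s ^ β ∂ν)⁻¹ : ℝ) := by
  rw [logResolvent, complexMGF_ofReal, ← Complex.ofReal_add, ← Complex.ofReal_inv, mgf]
  simp_rw [Real.rpow_def_of_pos hs, id]

variable (hν : ∀ᵐ β ∂ν, β ∈ Icc b0 b1) (hb0 : 0 < b0) (hb1 : b1 < 1)
  (hS : 0 < ∫ β, Real.sin (β * Real.pi) ∂ν) {lam : ℝ} (hlam : 0 ≤ lam)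
include hν hb0 hb1 hS hlam

theorem measurable_spectralDensity : Measurable (spectralDensity ν lam) :=
  ((continuous_logSpectral hν hb0 hb1 hS hlam).measurable.comp Real.measurable_log).const_mul _

/-- The Stieltjes representation of the resolvent. -/
theorem lintegral_spectralDensity {s : ℝ} (hs : 0 < s) :
    ∫⁻ r in Ioi (0 : ℝ), ENNReal.ofReal (spectralDensity ν lam r) * ENNReal.ofReal (s + r)⁻¹ =
      ENNReal.ofReal (lam + ∫ β, s ^ β ∂ν)⁻¹ := by
  have himg : Real.exp '' univ = Ioi 0 := by rw [image_univ, Real.range_exp]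
  have h := lintegral_logSpectral hν hb0 hb1 hS hlam (Real.log s)
  rw [logResolvent_log ν lam hs, Complex.ofReal_re, Real.exp_log hs] at h
  -- The change of variables `r = e^y` returns from logarithmic coordinates to the cut.
  rw [← himg, lintegral_image_eq_lintegral_abs_deriv_mul MeasurableSet.univ
    (fun x _ => (Real.hasDerivAt_exp x).hasDerivWithinAt) Real.exp_injective.injOn,
    Measure.restrict_univ]
  have hπ := Real.pi_pos
  rw [show (lam + ∫ β, s ^ β ∂ν)⁻¹ = Real.pi⁻¹ * (Real.pi * (lam + ∫ β, s ^ β ∂ν)⁻¹) by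
    field_simp, ENNReal.ofReal_mul (inv_nonneg.2 hπ.le), ← h,
    ← lintegral_const_mul' _ _ ENNReal.ofReal_ne_top]
  refine lintegral_congr fun x => ?_
  have hnn := logSpectral_nonneg hν hb0 hb1 lam x
  have hex := Real.exp_pos x
  rw [spectralDensity, Real.log_exp, Real.abs_exp, ← ENNReal.ofReal_mul (by positivity),
    ← ENNReal.ofReal_mul hex.le, ← ENNReal.ofReal_mul (by positivity)]
  congr 1
  rw [div_eq_mul_inv, add_comm s]
  ring

theorem laplace_resolventKernel {s : ℝ} (hs : 0 < s) :
    ∫⁻ t in Ioi (0 : ℝ), resolventKernel ν lam t * ENNReal.ofReal (Real.exp (-(s * t))) =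
      ENNReal.ofReal (lam + ∫ β, s ^ β ∂ν)⁻¹ := by
  have hm := measurable_spectralDensity hν hb0 hb1 hS hlam
  rw [← lintegral_spectralDensity hν hb0 hb1 hS hlam hs]
  simp_rw [resolventKernel]
  calc _ = ∫⁻ t in Ioi (0 : ℝ), ∫⁻ r in Ioi (0 : ℝ), ENNReal.ofReal (spectralDensity ν lam r) *
          ENNReal.ofReal (Real.exp (-((s + r) * t))) := by
        refine lintegral_congr fun t => ?_
        rw [← lintegral_mul_const' _ _ ENNReal.ofReal_ne_top]
        refine lintegral_congr fun r => ?_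
        rw [mul_assoc, ← ENNReal.ofReal_mul (Real.exp_nonneg _), ← Real.exp_add]
        ring_nf
    _ = ∫⁻ r in Ioi (0 : ℝ), ∫⁻ t in Ioi (0 : ℝ), ENNReal.ofReal (spectralDensity ν lam r) *
          ENNReal.ofReal (Real.exp (-((s + r) * t))) :=
        lintegral_lintegral_swap (by fun_prop)
    _ = _ := by
        refine setLIntegral_congr_fun measurableSet_Ioi fun r hr => ?_
        have : 0 < s + r := add_pos hs hr
        rw [lintegral_const_mul' _ _ ENNReal.ofReal_ne_top, lintegral_Ioi_exp this]

/-- The pointwise bound on the spectral density is a sum of two powers of `r`, and the Laplace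
transform of `r^(-b)` is `Γ(1 - b) t^(b - 1)`. -/
theorem resolventKernel_le {t : ℝ} (ht : 0 < t) :
    resolventKernel ν lam t ≤ ENNReal.ofReal (((∫ β, Real.sin (β * Real.pi) ∂ν) * Real.pi)⁻¹ *
      (Real.Gamma (1 - b1) * t ^ (b1 - 1) + Real.Gamma (1 - b0) * t ^ (b0 - 1))) := by
  set A := ((∫ β, Real.sin (β * Real.pi) ∂ν) * Real.pi)⁻¹ with hA
  have hπ := Real.pi_pos
  have hA0 : 0 ≤ A := (inv_pos.2 (mul_pos hS hπ)).le
  -- Positivity of the sine integral excludes `ν = 0`, so `[b0, b1]` is nonempty; this gives `b0 <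
  -- 1`.
  obtain ⟨β, hβ⟩ : ∃ β, β ∈ Icc b0 b1 := by
    by_contra! hcon
    have : ν = 0 := by
      rw [← ae_eq_bot, ← empty_mem_iff_bot]
      filter_upwards [hν] with β hβ using hcon β hβ
    simp [this] at hS
  have hb0' : b0 < 1 := (hβ.1.trans hβ.2).trans_lt hb1
  have hg : ∀ b : ℝ, b < 1 → 0 ≤ Real.Gamma (1 - b) * t ^ (b - 1) := fun b hb =>
    mul_nonneg (Real.Gamma_nonneg_of_nonneg (by linarith)) (Real.rpow_nonneg ht.le _)
  rw [ENNReal.ofReal_mul hA0, ENNReal.ofReal_add (hg _ hb1) (hg _ hb0'),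
    ← lintegral_rpow_mul_exp hb1 ht, ← lintegral_rpow_mul_exp hb0' ht,
    ← lintegral_add_left (by fun_prop), ← lintegral_const_mul' _ _ ENNReal.ofReal_ne_top]
  refine setLIntegral_mono' measurableSet_Ioi fun r hr => ?_
  have hr' : 0 < r := hr
  rw [← add_mul, ← mul_assoc]
  gcongr
  rw [← ENNReal.ofReal_add (by positivity) (by positivity), ← ENNReal.ofReal_mul hA0]
  refine ENNReal.ofReal_le_ofReal ?_
  have := logSpectral_le hν hb0 hb1 hS hlam (Real.log r)
  have he : ∀ b : ℝ, Real.exp (-(b * Real.log r)) = r ^ (-b) := fun b => by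
    rw [Real.rpow_def_of_pos hr']; ring_nf
  rw [he, he] at this
  rw [spectralDensity, hA, mul_inv_rev, mul_assoc]
  exact mul_le_mul_of_nonneg_left this (inv_nonneg.2 hπ.le)

theorem resolventKernel_ne_top {t : ℝ} (ht : 0 < t) : resolventKernel ν lam t ≠ ∞ :=
  ne_top_of_le_ne_top ENNReal.ofReal_ne_top (resolventKernel_le hν hb0 hb1 hS hlam ht)

theorem continuousOn_resolventKernel : ContinuousOn (resolventKernel ν lam) (Ioi 0) := by
  have hm := measurable_spectralDensity hν hb0 hb1 hS hlam
  have heq : resolventKernel ν lam = fun t => ∫⁻ r, ENNReal.ofReal (Real.exp (-(t * r)))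
      ∂((volume.restrict (Ioi (0 : ℝ))).withDensity
        fun r => ENNReal.ofReal (spectralDensity ν lam r)) := by
    funext t
    rw [lintegral_withDensity_eq_lintegral_mul _ (by fun_prop) (by fun_prop)]
    rfl
  rw [heq]
  refine continuousOn_laplace isOpen_Ioi fun t ht => ?_
  exact (congrFun heq t).symm.trans_ne
    (resolventKernel_ne_top hν hb0 hb1 hS hlam ht)

end Kernel

/-! ### The order measure and the Lévy tail of the mixture. -/

theorem continuousOn_Gamma_one_sub : ContinuousOn (fun β : ℝ => Real.Gamma (1 - β)) (Iio 1) := by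
  intro β hβ
  have hβ' : 0 < 1 - β := sub_pos.2 hβ
  refine ContinuousAt.continuousWithinAt (ContinuousAt.comp (g := Real.Gamma)
    (f := fun β : ℝ => 1 - β) (x := β) ?_ (by fun_prop))
  refine (Real.differentiableAt_Gamma fun m => ?_).continuousAt
  have : (0 : ℝ) ≤ m := m.cast_nonneg
  linarith

theorem aemeasurable_Gamma_one_sub (μ : Measure ℝ) :
    AEMeasurable (fun β : ℝ => Real.Gamma (1 - β)) (μ.restrict (Ioo 0 1)) :=
  (continuousOn_Gamma_one_sub.mono Ioo_subset_Iio_self).aemeasurable measurableSet_Ioo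

theorem lintegral_orderMeasure (μ : Measure ℝ) {g : ℝ → ℝ≥0∞}
    (hg : AEMeasurable g (μ.restrict (Ioo 0 1))) :
    ∫⁻ β, g β ∂(orderMeasure μ) =
      ∫⁻ β in Ioo (0 : ℝ) 1, ENNReal.ofReal (Real.Gamma (1 - β)) * g β ∂μ :=
  lintegral_withDensity_eq_lintegral_mul₀ (aemeasurable_Gamma_one_sub μ).ennreal_ofReal hg

/-- The Caputo normalisation cancels the density of `ν` against `μ`. Integrating `(t - r)^(-β)` over
the orders then produces exactly the Lévy tail at `t - r`. -/
theorem lintegral_orderMeasure_inv_Gamma_mul (μ : Measure ℝ) {g : ℝ → ℝ≥0∞} (hg : Measurable g) :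
    ∫⁻ β, ENNReal.ofReal (Real.Gamma (1 - β))⁻¹ * g β ∂(orderMeasure μ) =
      ∫⁻ β in Ioo (0 : ℝ) 1, g β ∂μ := by
  have hm : AEMeasurable (fun β => ENNReal.ofReal (Real.Gamma (1 - β))⁻¹ * g β)
      (μ.restrict (Ioo 0 1)) :=
    (aemeasurable_Gamma_one_sub μ).inv.ennreal_ofReal.mul hg.aemeasurable
  rw [lintegral_orderMeasure μ hm]
  refine setLIntegral_congr_fun measurableSet_Ioo fun β hβ => ?_
  have hpos : 0 < Real.Gamma (1 - β) := Real.Gamma_pos_of_pos (by linarith [hβ.2])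
  rw [← mul_assoc, ← ENNReal.ofReal_mul hpos.le, mul_inv_cancel₀ hpos.ne', ENNReal.ofReal_one,
    one_mul]

theorem ae_mem_Ioo_orderMeasure (μ : Measure ℝ) : ∀ᵐ β ∂(orderMeasure μ), β ∈ Ioo (0 : ℝ) 1 :=
  (withDensity_absolutelyContinuous _ _).ae_le (ae_restrict_mem measurableSet_Ioo)

theorem mixtureLevyMeasure_Iic_zero (μ : Measure ℝ) : mixtureLevyMeasure μ (Iic 0) = 0 := by
  refine withDensity_absolutelyContinuous _ _ ?_
  rw [Measure.restrict_apply measurableSet_Iic, Iic_inter_Ioi, Ioc_self, measure_empty]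

theorem antitone_measure_Ioi (m : Measure ℝ) : Antitone fun t => m (Ioi t) := fun _ _ h =>
  measure_mono (Ioi_subset_Ioi h)

section Mixture

variable {μ : Measure ℝ} [IsFiniteMeasure (orderMeasure μ)]

theorem lintegral_rpow_orderMeasure {b0 b1 s : ℝ} (hν : ∀ᵐ β ∂(orderMeasure μ), β ∈ Icc b0 b1)
    (hs : 0 < s) :
    ∫⁻ β, ENNReal.ofReal (s ^ β) ∂(orderMeasure μ) =
      ENNReal.ofReal (∫ β, s ^ β ∂(orderMeasure μ)) := by
  rw [ofReal_integral_eq_lintegral_ofReal]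
  · simpa only [← Real.rpow_def_of_pos hs] using integrable_exp_mul_of_support hν (Real.log s)
  · exact Eventually.of_forall fun β => Real.rpow_nonneg hs.le β

theorem integral_rpow_orderMeasure_pos {b0 b1 : ℝ} (hν : ∀ᵐ β ∂(orderMeasure μ), β ∈ Icc b0 b1)
    (hb0 : 0 < b0) (hb1 : b1 < 1) (hS : 0 < ∫ β, Real.sin (β * Real.pi) ∂(orderMeasure μ))
    {s : ℝ} (hs : 0 < s) :
    0 < ∫ β, s ^ β ∂(orderMeasure μ) := by
  simp_rw [Real.rpow_def_of_pos hs]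
  have hle : ∫ β, Real.exp (Real.log s * β) * Real.sin (β * Real.pi) ∂(orderMeasure μ) ≤
      ∫ β, Real.exp (Real.log s * β) ∂(orderMeasure μ) :=
    integral_mono (integrable_exp_mul_sin hν _) (integrable_exp_mul_of_support hν _) fun β =>
      mul_le_of_le_one_right (Real.exp_nonneg _) (Real.sin_le_one _)
  refine lt_of_lt_of_le ?_ hle
  rcases le_total 0 (Real.log s) with hx | hx
  · exact lt_of_lt_of_le (by positivity) (mul_exp_le_of_nonneg hν hb0 hb1 hx)
  · exact lt_of_lt_of_le (by positivity) (mul_exp_le_of_nonpos hν hb0 hb1 hx)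

/-- By Tonelli each `t^(-β)` contributes `Γ(1 - β) s^(β - 1)`, and the Gamma factor turns `μ` into
`ν`. -/
theorem laplace_tail_mixture [SFinite μ] {b0 b1 s : ℝ} (hν : ∀ᵐ β ∂(orderMeasure μ), β ∈ Icc b0 b1)
    (hs : 0 < s) :
    ∫⁻ t in Ioi (0 : ℝ), mixtureLevyMeasure μ (Ioi t) * ENNReal.ofReal (Real.exp (-(s * t))) =
      ENNReal.ofReal ((∫ β, s ^ β ∂(orderMeasure μ)) / s) := by
  calc _ = ∫⁻ t in Ioi (0 : ℝ), ∫⁻ β in Ioo (0 : ℝ) 1,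
          ENNReal.ofReal (t ^ (-β)) * ENNReal.ofReal (Real.exp (-(s * t))) ∂μ := by
        refine setLIntegral_congr_fun measurableSet_Ioi fun t ht => ?_
        rw [mixtureLevyMeasure_Ioi μ ht, lintegral_mul_const' _ _ ENNReal.ofReal_ne_top]
    _ = ∫⁻ β in Ioo (0 : ℝ) 1, (∫⁻ t in Ioi (0 : ℝ),
          ENNReal.ofReal (t ^ (-β)) * ENNReal.ofReal (Real.exp (-(s * t)))) ∂μ :=
        lintegral_lintegral_swap (by fun_prop)
    _ = ∫⁻ β in Ioo (0 : ℝ) 1,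
          ENNReal.ofReal (Real.Gamma (1 - β)) * ENNReal.ofReal (s ^ (β - 1)) ∂μ := by
        refine setLIntegral_congr_fun measurableSet_Ioo fun β hβ => ?_
        rw [lintegral_rpow_mul_exp hβ.2 hs,
          ENNReal.ofReal_mul (Real.Gamma_nonneg_of_nonneg (by linarith [hβ.2]))]
    _ = ∫⁻ β, ENNReal.ofReal (s ^ β) * ENNReal.ofReal s⁻¹ ∂(orderMeasure μ) := by
        rw [← lintegral_orderMeasure μ (by fun_prop)]
        refine lintegral_congr fun β => ?_
        rw [Real.rpow_sub_one hs.ne', div_eq_mul_inv, ENNReal.ofReal_mul (Real.rpow_nonneg hs.le _)]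
    _ = _ := by
        rw [lintegral_mul_const' _ _ ENNReal.ofReal_ne_top, lintegral_rpow_orderMeasure hν hs,
          div_eq_mul_inv, ENNReal.ofReal_mul (integral_nonneg fun β => Real.rpow_nonneg hs.le β)]

theorem laplaceExponent_mixture [SFinite μ] {b0 b1 s : ℝ} (hν : ∀ᵐ β ∂(orderMeasure μ), β ∈ Icc b0 b1)
    (hs : 0 < s) :
    laplaceExponent (mixtureLevyMeasure μ) s = ∫ β, s ^ β ∂(orderMeasure μ) := by
  have hnull := mixtureLevyMeasure_Iic_zero μ
  have hres : (mixtureLevyMeasure μ).restrict (Ioi 0) = mixtureLevyMeasure μ := by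
    refine Measure.restrict_eq_self_of_ae_mem ?_
    rw [ae_iff]
    simpa [Iic] using hnull
  have hL := lintegral_tail_mul_exp _ (measure_mono_null Iio_subset_Iic_self hnull) hs
  rw [laplace_tail_mixture hν hs] at hL
  rw [laplaceExponent, integral_eq_lintegral_of_nonneg_ae]
  · have h2 : ∫⁻ x in Ioi (0 : ℝ), ENNReal.ofReal (1 - Real.exp (-(s * x)))
        ∂(mixtureLevyMeasure μ) = ENNReal.ofReal s *
          ∫⁻ x, ENNReal.ofReal ((1 - Real.exp (-(s * x))) / s) ∂(mixtureLevyMeasure μ) := by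
      rw [hres, ← lintegral_const_mul' _ _ ENNReal.ofReal_ne_top]
      refine lintegral_congr fun x => ?_
      rw [← ENNReal.ofReal_mul hs.le, mul_div_cancel₀ _ hs.ne']
    rw [h2, ← hL, ← ENNReal.ofReal_mul hs.le, mul_div_cancel₀ _ hs.ne', ENNReal.toReal_ofReal]
    exact integral_nonneg fun β => Real.rpow_nonneg hs.le β
  · filter_upwards [ae_restrict_mem measurableSet_Ioi] with x hx
    have : 0 < s * x := mul_pos hs hx
    simpa using this.le
  · fun_prop

end Mixture

section Tail

variable {μ : Measure ℝ} [IsFiniteMeasure μ]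

/-- As a function of `log t` the tail is itself a Laplace transform, so its finiteness and
continuity come from the general results. -/
theorem mixtureLevyMeasure_Ioi_eq_laplace {t : ℝ} (ht : 0 < t) :
    mixtureLevyMeasure μ (Ioi t) =
      ∫⁻ β, ENNReal.ofReal (Real.exp (-(Real.log t * β))) ∂(μ.restrict (Ioo 0 1)) := by
  rw [mixtureLevyMeasure_Ioi μ ht]
  refine lintegral_congr fun β => ?_
  rw [Real.rpow_def_of_pos ht]
  ring_nf

theorem laplace_restrict_ne_top (x : ℝ) :
    ∫⁻ β, ENNReal.ofReal (Real.exp (-(x * β))) ∂(μ.restrict (Ioo 0 1)) ≠ ∞ := by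
  have h := integrable_exp_mul_of_support (ν := μ.restrict (Ioo 0 1)) (b0 := 0) (b1 := 1)
    ((ae_restrict_mem measurableSet_Ioo).mono fun β hβ => Ioo_subset_Icc_self hβ) (-x)
  rw [integrable_congr (g := fun β => Real.exp (-(x * β)))
    (Eventually.of_forall fun β => by simp only [neg_mul])] at h
  exact ((hasFiniteIntegral_iff_ofReal
    (Eventually.of_forall fun β => Real.exp_nonneg _)).1 h.2).ne

theorem mixtureLevyMeasure_Ioi_ne_top {t : ℝ} (ht : 0 < t) : mixtureLevyMeasure μ (Ioi t) ≠ ∞ := by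
  rw [mixtureLevyMeasure_Ioi_eq_laplace ht]
  exact laplace_restrict_ne_top _

theorem continuousOn_mixtureLevyMeasure_Ioi :
    ContinuousOn (fun t => mixtureLevyMeasure μ (Ioi t)) (Ioi 0) := by
  have h := continuousOn_laplace (m := μ.restrict (Ioo 0 1)) isOpen_univ
    fun x _ => laplace_restrict_ne_top x
  refine ((h.comp (Real.continuousOn_log.mono ?_) (mapsTo_univ _ _)).congr ?_ :
    ContinuousOn _ (Ioi (0 : ℝ)))
  · intro t ht
    exact ne_of_gt ht
  · intro t ht
    exact mixtureLevyMeasure_Ioi_eq_laplace ht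

end Tail

theorem exponentialTimeLaw_univ {Ω : Type*} [MeasurableSpace Ω] {P : Measure Ω}
    [IsProbabilityMeasure P] {W : ℝ≥0 → Ω → ℝ} {φ : Measure ℝ} (hW : IsSubordinator P W φ) {lam : ℝ}
    (hlam : 0 < lam) : exponentialTimeLaw P W lam univ = 1 := by
  have h0 : laplaceExponent φ 0 = 0 := by simp [laplaceExponent]
  have := hW.laplace_exponentialTimeLaw hlam le_rfl h0.ge
  simpa [h0, hlam.ne'] using this

/-! ### The law at the exponential time and the convolution equation. -/

section Core

variable {Ω : Type*} [MeasurableSpace Ω] {P : Measure Ω} [IsProbabilityMeasure P]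
  {W : ℝ≥0 → Ω → ℝ} {μ : Measure ℝ} [IsFiniteMeasure μ] [IsFiniteMeasure (orderMeasure μ)]
  {b0 b1 : ℝ} (hW : IsSubordinator P W (mixtureLevyMeasure μ))
  (hν : ∀ᵐ β ∂(orderMeasure μ), β ∈ Icc b0 b1) (hb0 : 0 < b0) (hb1 : b1 < 1)
  (hS : 0 < ∫ β, Real.sin (β * Real.pi) ∂(orderMeasure μ)) {lam : ℝ} (hlam : 0 < lam)

include hW hν hb0 hb1 hS hlam

theorem exponentialTimeLaw_eq : exponentialTimeLaw P W lam =
    (volume.restrict (Ioi (0 : ℝ))).withDensity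
      fun t => ENNReal.ofReal lam * resolventKernel (orderMeasure μ) lam t := by
  have hlap : ∀ s : ℝ, 0 < s →
      ∫⁻ x, ENNReal.ofReal (Real.exp (-(s * x))) ∂(exponentialTimeLaw P W lam) =
        ENNReal.ofReal (lam / (lam + ∫ β, s ^ β ∂(orderMeasure μ))) := by
    intro s hs
    have hψ := laplaceExponent_mixture hν hs
    have hpos := integral_rpow_orderMeasure_pos hν hb0 hb1 hS hs
    rw [hW.laplace_exponentialTimeLaw hlam hs.le (hψ ▸ hpos.le), hψ]
  have hm := measurable_resolventKernel (orderMeasure μ) lam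
  refine measure_ext_of_laplace (fun s hs => ?_) fun s hs => ?_
  · rw [hlap s hs]
    exact ENNReal.ofReal_ne_top
  · rw [hlap s hs, lintegral_withDensity_eq_lintegral_mul _ (by fun_prop) (by fun_prop)]
    simp only [Pi.mul_apply, mul_assoc]
    rw [lintegral_const_mul' _ _ ENNReal.ofReal_ne_top,
      laplace_resolventKernel hν hb0 hb1 hS hlam.le hs, ← ENNReal.ofReal_mul hlam.le,
      div_eq_mul_inv]

/-- Integrability up to `0` comes from total mass: `λ` times the kernel is the density of a
probability law. -/
theorem intervalIntegrable_resolventKernel {t : ℝ} (ht : 0 ≤ t) :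
    IntervalIntegrable (fun r => (resolventKernel (orderMeasure μ) lam r).toReal) volume 0 t := by
  rw [intervalIntegrable_iff_integrableOn_Ioc_of_le ht]
  refine integrable_toReal_of_lintegral_ne_top
    (measurable_resolventKernel (orderMeasure μ) lam).aemeasurable ?_
  have h1 := exponentialTimeLaw_univ hW hlam
  rw [exponentialTimeLaw_eq hW hν hb0 hb1 hS hlam, withDensity_apply _ MeasurableSet.univ,
    Measure.restrict_univ, lintegral_const_mul' _ _ ENNReal.ofReal_ne_top] at h1
  have h2 : ∫⁻ r in Ioi (0 : ℝ), resolventKernel (orderMeasure μ) lam r ≠ ∞ := by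
    intro h
    rw [h, ENNReal.mul_top (by simpa using hlam)] at h1
    exact ENNReal.top_ne_one h1
  exact ne_top_of_le_ne_top h2 (lintegral_mono_set Ioc_subset_Ioi_self)

theorem laplaceInverse_eq_integral {t : ℝ} (ht : 0 ≤ t) :
    laplaceInverse P W t lam =
      1 - lam * ∫ r in (0 : ℝ)..t, (resolventKernel (orderMeasure μ) lam r).toReal := by
  have hψ : 0 < laplaceExponent (mixtureLevyMeasure μ) 1 := by
    rw [laplaceExponent_mixture hν one_pos]
    exact integral_rpow_orderMeasure_pos hν hb0 hb1 hS one_pos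
  rw [hW.laplaceInverse_eq hψ hlam, exponentialTimeLaw_eq hW hν hb0 hb1 hS hlam,
    withDensity_apply _ measurableSet_Iic, Measure.restrict_restrict measurableSet_Iic,
    inter_comm, Ioi_inter_Iic, lintegral_const_mul' _ _ ENNReal.ofReal_ne_top, ENNReal.toReal_mul,
    ENNReal.toReal_ofReal hlam.le, intervalIntegral.integral_of_le ht, integral_toReal]
  · exact (measurable_resolventKernel (orderMeasure μ) lam).aemeasurable
  · filter_upwards [ae_restrict_mem measurableSet_Ioc] with r hr
    exact (resolventKernel_ne_top hν hb0 hb1 hS hlam.le hr.1).lt_top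

theorem hasDerivAt_laplaceInverse {t : ℝ} (ht : 0 < t) :
    HasDerivAt (fun r => laplaceInverse P W r lam)
      (-(lam * (resolventKernel (orderMeasure μ) lam t).toReal)) t := by
  have hcont : ContinuousAt (fun r => (resolventKernel (orderMeasure μ) lam r).toReal) t :=
    (ENNReal.tendsto_toReal (resolventKernel_ne_top hν hb0 hb1 hS hlam.le ht)).comp
      ((continuousOn_resolventKernel hν hb0 hb1 hS hlam.le).continuousAt (Ioi_mem_nhds ht))
  have hd := intervalIntegral.integral_hasDerivAt_right
    (intervalIntegrable_resolventKernel hW hν hb0 hb1 hS hlam ht.le)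
    (measurable_resolventKernel (orderMeasure μ) lam).ennreal_toReal.stronglyMeasurable.stronglyMeasurableAtFilter
    hcont
  refine ((hd.const_mul lam).const_sub 1).congr_of_eventuallyEq ?_
  filter_upwards [Ioi_mem_nhds ht] with r hr
  exact laplaceInverse_eq_integral hW hν hb0 hb1 hS hlam (le_of_lt hr)

theorem continuousOn_laplaceInverse :
    ContinuousOn (fun t => laplaceInverse P W t lam) (Ici 0) := by
  have h : ContinuousOn (fun t => 1 - lam *
      ∫ r in (0 : ℝ)..t, (resolventKernel (orderMeasure μ) lam r).toReal) (Ici 0) := by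
    intro t ht
    have ht' : (0 : ℝ) ≤ t := ht
    have hint := intervalIntegrable_resolventKernel hW hν hb0 hb1 hS hlam
      (t := t + 1) (by linarith)
    have hc := intervalIntegral.continuousOn_primitive_interval'
      hint (left_mem_uIcc) t (by rw [uIcc_of_le (by linarith)]; exact ⟨ht', by linarith⟩)
    refine ContinuousWithinAt.mono_of_mem_nhdsWithin
      (continuousWithinAt_const.sub (hc.const_mul lam)) ?_
    rw [uIcc_of_le (by linarith)]
    exact mem_nhdsWithin.2 ⟨Iio (t + 1), isOpen_Iio, by simp, fun x hx => ⟨hx.2, hx.1.le⟩⟩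
  exact h.congr fun t ht => laplaceInverse_eq_integral hW hν hb0 hb1 hS hlam ht

theorem exponentialTimeLaw_Ioi (t : ℝ) :
    exponentialTimeLaw P W lam (Ioi t) = ENNReal.ofReal (laplaceInverse P W t lam) := by
  have hψ : 0 < laplaceExponent (mixtureLevyMeasure μ) 1 := by
    rw [laplaceExponent_mixture hν one_pos]
    exact integral_rpow_orderMeasure_pos hν hb0 hb1 hS one_pos
  have : IsProbabilityMeasure (exponentialTimeLaw P W lam) :=
    ⟨exponentialTimeLaw_univ hW hlam⟩
  rw [hW.laplaceInverse_eq hψ hlam, ← compl_Iic, prob_compl_eq_one_sub measurableSet_Iic,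
    ENNReal.ofReal_sub _ ENNReal.toReal_nonneg, ENNReal.ofReal_one,
    ENNReal.ofReal_toReal (measure_ne_top _ _)]

/-- The Laplace transform of `h(·, λ)`. -/
theorem laplace_laplaceInverse {s : ℝ} (hs : 0 < s) :
    ∫⁻ t in Ioi (0 : ℝ), ENNReal.ofReal (laplaceInverse P W t lam) *
        ENNReal.ofReal (Real.exp (-(s * t))) =
      ENNReal.ofReal (lam + ∫ β, s ^ β ∂(orderMeasure μ))⁻¹ *
        ENNReal.ofReal ((∫ β, s ^ β ∂(orderMeasure μ)) / s) := by
  set m := exponentialTimeLaw P W lam with hm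
  set ψ := ∫ β, s ^ β ∂(orderMeasure μ) with hψdef
  have hψpos : 0 < ψ := integral_rpow_orderMeasure_pos hν hb0 hb1 hS hs
  have hψ := laplaceExponent_mixture hν hs
  have hmp : IsProbabilityMeasure m := ⟨exponentialTimeLaw_univ hW hlam⟩
  have hnull : m (Iic 0) = 0 := by
    rw [hm, exponentialTimeLaw_eq hW hν hb0 hb1 hS hlam]
    refine withDensity_absolutelyContinuous _ _ ?_
    rw [Measure.restrict_apply measurableSet_Iic, Iic_inter_Ioi, Ioc_self, measure_empty]
  have hpos : ∀ᵐ x ∂m, 0 ≤ x := by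
    rw [ae_iff]
    exact measure_mono_null (fun x hx => (not_le.1 hx).le) hnull
  simp_rw [← exponentialTimeLaw_Ioi hW hν hb0 hb1 hS hlam]
  rw [lintegral_tail_mul_exp _ (measure_mono_null Iio_subset_Iic_self hnull) hs]
  have hl : ∫⁻ x, ENNReal.ofReal (Real.exp (-(s * x))) ∂m = ENNReal.ofReal (lam / (lam + ψ)) := by
    rw [hW.laplace_exponentialTimeLaw hlam hs.le (hψ ▸ hψpos.le), hψ]
  -- The relation between the transforms of a law and of its tail is kept additive to avoid
  -- truncated subtraction; the finite second term is cancelled afterwards.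
  have hadd : (∫⁻ x, ENNReal.ofReal ((1 - Real.exp (-(s * x))) / s) ∂m) +
      ENNReal.ofReal s⁻¹ * ENNReal.ofReal (lam / (lam + ψ)) = ENNReal.ofReal s⁻¹ := by
    rw [← hl, ← lintegral_const_mul' _ _ ENNReal.ofReal_ne_top, ← lintegral_add_left (by fun_prop)]
    calc _ = ∫⁻ _, ENNReal.ofReal s⁻¹ ∂m := by
          refine lintegral_congr_ae ?_
          filter_upwards [hpos] with x hx
          have h1 : Real.exp (-(s * x)) ≤ 1 := by
            rw [Real.exp_le_one_iff]
            have := mul_nonneg hs.le hx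
            linarith
          rw [← ENNReal.ofReal_mul (inv_nonneg.2 hs.le),
            ← ENNReal.ofReal_add (div_nonneg (by linarith) hs.le) (by positivity)]
          congr 1
          field_simp
          ring
      _ = _ := by simp
  have htop : ENNReal.ofReal s⁻¹ * ENNReal.ofReal (lam / (lam + ψ)) ≠ ∞ :=
    ENNReal.mul_ne_top ENNReal.ofReal_ne_top ENNReal.ofReal_ne_top
  refine (ENNReal.add_left_inj htop).1 ?_
  rw [hadd, ← ENNReal.ofReal_mul (by positivity), ← ENNReal.ofReal_mul (by positivity),
    ← ENNReal.ofReal_add (by positivity) (by positivity)]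
  congr 1
  field_simp
  ring

/-- The convolution form of the eigenvalue equation. -/
theorem causalConv_eq_laplaceInverse {t : ℝ} (ht : 0 < t) :
    causalConv (resolventKernel (orderMeasure μ) lam) (fun r => mixtureLevyMeasure μ (Ioi r)) t =
      ENNReal.ofReal (laplaceInverse P W t lam) := by
  set f := resolventKernel (orderMeasure μ) lam with hf
  set κ : ℝ → ℝ≥0∞ := fun r => mixtureLevyMeasure μ (Ioi r) with hκ
  have hfm : Measurable f := measurable_resolventKernel _ _
  have hκa : Antitone κ := antitone_measure_Ioi _
  have hκm : Measurable κ := hκa.measurable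
  have hcm := measurable_causalConv hfm hκm
  have hhm : Measurable fun t => ENNReal.ofReal (laplaceInverse P W t lam) := by
    simp_rw [← exponentialTimeLaw_Ioi hW hν hb0 hb1 hS hlam]
    exact (antitone_measure_Ioi _).measurable
  have hlap : ∀ s : ℝ, 0 < s →
      ∫⁻ t in Ioi (0 : ℝ), causalConv f κ t * ENNReal.ofReal (Real.exp (-(s * t))) =
        ENNReal.ofReal (lam + ∫ β, s ^ β ∂(orderMeasure μ))⁻¹ *
          ENNReal.ofReal ((∫ β, s ^ β ∂(orderMeasure μ)) / s) := by
    intro s hs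
    rw [laplace_causalConv hfm hκm, laplace_resolventKernel hν hb0 hb1 hS hlam.le hs,
      laplace_tail_mixture hν hs]
  have hmeas : (volume.restrict (Ioi (0 : ℝ))).withDensity (causalConv f κ) =
      (volume.restrict (Ioi (0 : ℝ))).withDensity
        fun t => ENNReal.ofReal (laplaceInverse P W t lam) := by
    refine measure_ext_of_laplace (fun s hs => ?_) fun s hs => ?_
    · rw [lintegral_withDensity_eq_lintegral_mul _ hcm (by fun_prop)]
      simp only [Pi.mul_apply]
      rw [hlap s hs]
      exact ENNReal.mul_ne_top ENNReal.ofReal_ne_top ENNReal.ofReal_ne_top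
    · rw [lintegral_withDensity_eq_lintegral_mul _ hcm (by fun_prop),
        lintegral_withDensity_eq_lintegral_mul _ hhm (by fun_prop)]
      simp only [Pi.mul_apply]
      rw [hlap s hs, laplace_laplaceInverse hW hν hb0 hb1 hS hlam hs]
  have hae := (withDensity_eq_iff_of_sigmaFinite hcm.aemeasurable hhm.aemeasurable).1 hmeas
  -- Almost everywhere the convolution equals the finite `h`, so some `a` before `t` has a finite
  -- value. Continuity then holds past `a`, in particular at `t`.
  obtain ⟨a, ⟨ha0, hat⟩, ha⟩ : ∃ a ∈ Ioo 0 t, causalConv f κ a ≠ ∞ := by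
    have h1 : ∀ᵐ a ∂volume.restrict (Ioo 0 t), causalConv f κ a ≠ ∞ := by
      filter_upwards [ae_restrict_of_ae_restrict_of_subset Ioo_subset_Ioi_self hae] with a ha
      rw [ha]
      exact ENNReal.ofReal_ne_top
    have hne : (volume.restrict (Ioo 0 t)) ≠ 0 := by
      rw [Ne, Measure.restrict_eq_zero, Real.volume_Ioo]
      simpa using ht
    have : NeBot (ae (volume.restrict (Ioo 0 t))) := ae_neBot.2 hne
    obtain ⟨a, ha, ha'⟩ := (h1.and (ae_restrict_mem measurableSet_Ioo)).exists
    exact ⟨a, ha', ha⟩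
  have hfa : Antitone f := antitone_resolventKernel _ _
  have hcc : ContinuousOn (causalConv f κ) (Ioi a) :=
    continuousOn_causalConv hfm hκm (hfa.antitoneOn _) (hκa.antitoneOn _)
      (continuousOn_resolventKernel hν hb0 hb1 hS hlam.le) continuousOn_mixtureLevyMeasure_Ioi
      (fun _ h => resolventKernel_ne_top hν hb0 hb1 hS hlam.le h)
      (fun _ h => mixtureLevyMeasure_Ioi_ne_top h) ha0 ha
  have hhc : ContinuousOn (fun t => ENNReal.ofReal (laplaceInverse P W t lam)) (Ioi a) :=
    ENNReal.continuous_ofReal.comp_continuousOn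
      ((continuousOn_laplaceInverse hW hν hb0 hb1 hS hlam).mono fun x hx =>
        (ha0.trans hx).le)
  exact Measure.eqOn_open_of_ae_eq
    (ae_restrict_of_ae_restrict_of_subset (Ioi_subset_Ioi ha0.le) hae) isOpen_Ioi hcc hhc hat

end Core

/-! ### The classical solution and the derivative bound. -/

section Solution

variable {Ω : Type*} [MeasurableSpace Ω] {P : Measure Ω} [IsProbabilityMeasure P]
  {W : ℝ≥0 → Ω → ℝ} {μ : Measure ℝ} [IsFiniteMeasure μ] [IsFiniteMeasure (orderMeasure μ)]
  {b0 b1 : ℝ} (hW : IsSubordinator P W (mixtureLevyMeasure μ))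
  (hν : ∀ᵐ β ∂(orderMeasure μ), β ∈ Icc b0 b1) (hb0 : 0 < b0) (hb1 : b1 < 1)
  (hS : 0 < ∫ β, Real.sin (β * Real.pi) ∂(orderMeasure μ)) {lam : ℝ} (hlam : 0 < lam)

theorem laplaceInverse_nonneg {Ω : Type*} [MeasurableSpace Ω] (P : Measure Ω) (W : ℝ≥0 → Ω → ℝ)
    (t lam : ℝ) : 0 ≤ laplaceInverse P W t lam :=
  integral_nonneg fun _ => Real.exp_nonneg _

include hW hν hb0 hb1 hS hlam

theorem deriv_laplaceInverse {t : ℝ} (ht : 0 < t) :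
    deriv (fun r => laplaceInverse P W r lam) t =
      -(lam * (resolventKernel (orderMeasure μ) lam t).toReal) :=
  (hasDerivAt_laplaceInverse hW hν hb0 hb1 hS hlam ht).deriv

/-- The negated integrand of the distributed order derivative is nonnegative and has integral
`λ h(t, λ)`. -/
theorem lintegral_caputo_prod {t : ℝ} (ht : 0 < t) :
    ∫⁻ q : ℝ × ℝ, ENNReal.ofReal ((Real.Gamma (1 - q.1))⁻¹ *
        (lam * (resolventKernel (orderMeasure μ) lam q.2).toReal * (t - q.2) ^ (-q.1)))
        ∂((orderMeasure μ).prod (volume.restrict (Ioo 0 t))) =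
      ENNReal.ofReal (lam * laplaceInverse P W t lam) := by
  set f := resolventKernel (orderMeasure μ) lam with hf
  have hfm : Measurable f := measurable_resolventKernel _ _
  have hΓ : AEMeasurable (fun β : ℝ => Real.Gamma (1 - β)) (orderMeasure μ) :=
    (aemeasurable_Gamma_one_sub μ).mono_ac (withDensity_absolutelyContinuous _ _)
  have hfr : Measurable fun r => (f r).toReal := hfm.ennreal_toReal
  have hm2 : Measurable fun q : ℝ × ℝ =>
      lam * (f q.2).toReal * (t - q.2) ^ (-q.1) := by fun_prop
  have hmeas : AEMeasurable (fun q : ℝ × ℝ => ENNReal.ofReal ((Real.Gamma (1 - q.1))⁻¹ *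
      (lam * (f q.2).toReal * (t - q.2) ^ (-q.1))))
      ((orderMeasure μ).prod (volume.restrict (Ioo 0 t))) :=
    (hΓ.comp_fst.inv.mul hm2.aemeasurable).ennreal_ofReal
  have hmg : Measurable fun q : ℝ × ℝ => f q.2 * ENNReal.ofReal ((t - q.2) ^ (-q.1)) := by
    fun_prop
  rw [lintegral_prod _ hmeas]
  calc _ = ∫⁻ β, ENNReal.ofReal (Real.Gamma (1 - β))⁻¹ * (ENNReal.ofReal lam *
          ∫⁻ r in Ioo 0 t, f r * ENNReal.ofReal ((t - r) ^ (-β))) ∂(orderMeasure μ) := by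
        refine lintegral_congr_ae ?_
        filter_upwards [ae_mem_Ioo_orderMeasure μ] with β hβ
        rw [← lintegral_const_mul' _ _ ENNReal.ofReal_ne_top,
          ← lintegral_const_mul' _ _ ENNReal.ofReal_ne_top]
        refine setLIntegral_congr_fun measurableSet_Ioo fun r hr => ?_
        have hΓ0 : 0 ≤ Real.Gamma (1 - β) := Real.Gamma_nonneg_of_nonneg (by linarith [hβ.2])
        rw [ENNReal.ofReal_mul (inv_nonneg.2 hΓ0),
          ENNReal.ofReal_mul (mul_nonneg hlam.le ENNReal.toReal_nonneg),
          ENNReal.ofReal_mul hlam.le, mul_assoc (ENNReal.ofReal lam),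
          ENNReal.ofReal_toReal (resolventKernel_ne_top hν hb0 hb1 hS hlam.le hr.1)]
    _ = ∫⁻ β in Ioo (0 : ℝ) 1, ENNReal.ofReal lam *
          (∫⁻ r in Ioo 0 t, f r * ENNReal.ofReal ((t - r) ^ (-β))) ∂μ :=
        lintegral_orderMeasure_inv_Gamma_mul μ (hmg.lintegral_prod_right'.const_mul _)
    _ = ENNReal.ofReal lam * ∫⁻ r in Ioo 0 t, ∫⁻ β in Ioo (0 : ℝ) 1,
          f r * ENNReal.ofReal ((t - r) ^ (-β)) ∂μ := by
        rw [lintegral_const_mul' _ _ ENNReal.ofReal_ne_top,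
          lintegral_lintegral_swap hmg.aemeasurable]
    _ = ENNReal.ofReal lam * causalConv f (fun r => mixtureLevyMeasure μ (Ioi r)) t := by
        congr 1
        refine setLIntegral_congr_fun measurableSet_Ioo fun r hr => ?_
        beta_reduce
        rw [mixtureLevyMeasure_Ioi μ (sub_pos.2 hr.2), lintegral_const_mul' _ _
          (resolventKernel_ne_top hν hb0 hb1 hS hlam.le hr.1)]
    _ = _ := by
        rw [causalConv_eq_laplaceInverse hW hν hb0 hb1 hS hlam ht, ENNReal.ofReal_mul hlam.le]

/-- Since `deriv h = -λ f` with `f ≥ 0`, the integrand has one sign, so the finite Tonelli value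
gives integrability and the integral together. -/
theorem integrable_and_integral_caputo_prod {t : ℝ} (ht : 0 < t) :
    DistributedDerivExists μ (fun r => laplaceInverse P W r lam) t ∧
    ∫ q : ℝ × ℝ, (Real.Gamma (1 - q.1))⁻¹ *
        (deriv (fun r => laplaceInverse P W r lam) q.2 * (t - q.2) ^ (-q.1))
        ∂((orderMeasure μ).prod (volume.restrict (Ioo 0 t))) =
      -lam * laplaceInverse P W t lam := by
  have hL := lintegral_caputo_prod hW hν hb0 hb1 hS hlam ht
  set f := resolventKernel (orderMeasure μ) lam with hf
  set N : ℝ × ℝ → ℝ := fun q => (Real.Gamma (1 - q.1))⁻¹ *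
    (lam * (f q.2).toReal * (t - q.2) ^ (-q.1)) with hN
  have hfm : Measurable f := measurable_resolventKernel _ _
  have hfr : Measurable fun r => (f r).toReal := hfm.ennreal_toReal
  have hΓ : AEMeasurable (fun β : ℝ => Real.Gamma (1 - β)) (orderMeasure μ) :=
    (aemeasurable_Gamma_one_sub μ).mono_ac (withDensity_absolutelyContinuous _ _)
  have hm2 : Measurable fun q : ℝ × ℝ =>
      lam * (f q.2).toReal * (t - q.2) ^ (-q.1) := by fun_prop
  have hNm : AEMeasurable N ((orderMeasure μ).prod (volume.restrict (Ioo 0 t))) :=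
    hΓ.comp_fst.inv.mul hm2.aemeasurable
  have hmem : ∀ᵐ q ∂((orderMeasure μ).prod (volume.restrict (Ioo 0 t))),
      q.1 ∈ Ioo (0 : ℝ) 1 ∧ q.2 ∈ Ioo 0 t :=
    (Measure.quasiMeasurePreserving_fst.ae (ae_mem_Ioo_orderMeasure μ)).and
      (Measure.quasiMeasurePreserving_snd.ae (ae_restrict_mem measurableSet_Ioo))
  have hNnn : 0 ≤ᵐ[(orderMeasure μ).prod (volume.restrict (Ioo 0 t))] N := by
    filter_upwards [hmem] with q hq
    exact mul_nonneg (inv_nonneg.2 (Real.Gamma_nonneg_of_nonneg (by linarith [hq.1.2])))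
      (mul_nonneg (mul_nonneg hlam.le ENNReal.toReal_nonneg)
        (Real.rpow_nonneg (by linarith [hq.2.2]) _))
  have hNint : Integrable N ((orderMeasure μ).prod (volume.restrict (Ioo 0 t))) := by
    refine ⟨hNm.aestronglyMeasurable, (hasFiniteIntegral_iff_ofReal hNnn).2 ?_⟩
    rw [hL]
    exact ENNReal.ofReal_lt_top
  have heq : (fun q : ℝ × ℝ => (Real.Gamma (1 - q.1))⁻¹ *
      (deriv (fun r => laplaceInverse P W r lam) q.2 * (t - q.2) ^ (-q.1)))
      =ᵐ[(orderMeasure μ).prod (volume.restrict (Ioo 0 t))] fun q => -N q := by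
    filter_upwards [hmem] with q hq
    rw [deriv_laplaceInverse hW hν hb0 hb1 hS hlam hq.2.1, hN]
    ring
  refine ⟨hNint.neg.congr heq.symm, ?_⟩
  rw [integral_congr_ae heq, integral_neg, integral_eq_lintegral_of_nonneg_ae hNnn
    hNm.aestronglyMeasurable, hL, ENNReal.toReal_ofReal
    (mul_nonneg hlam.le (laplaceInverse_nonneg P W t lam)), neg_mul]

theorem isClassicalEigenSolution_laplaceInverse :
    IsClassicalEigenSolution μ lam fun t => laplaceInverse P W t lam where
  continuousOn := continuousOn_laplaceInverse hW hν hb0 hb1 hS hlam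
  contDiffOn := by
    rw [contDiffOn_one_iff_derivWithin isOpen_Ioi.uniqueDiffOn]
    have hd : ∀ t ∈ Ioi (0 : ℝ), HasDerivAt (fun r => laplaceInverse P W r lam)
        (-(lam * (resolventKernel (orderMeasure μ) lam t).toReal)) t := fun t ht =>
      hasDerivAt_laplaceInverse hW hν hb0 hb1 hS hlam ht
    refine ⟨fun t ht => (hd t ht).differentiableAt.differentiableWithinAt, ?_⟩
    have hc : ContinuousOn (fun t => (resolventKernel (orderMeasure μ) lam t).toReal) (Ioi 0) :=
      fun t ht => (ENNReal.tendsto_toReal (resolventKernel_ne_top hν hb0 hb1 hS hlam.le ht)).comp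
        (continuousOn_resolventKernel hν hb0 hb1 hS hlam.le t ht)
    exact (continuousOn_const.mul hc).neg.congr fun t ht =>
      (hd t ht).hasDerivWithinAt.derivWithin (isOpen_Ioi.uniqueDiffWithinAt ht)
  deriv_exists t ht := (integrable_and_integral_caputo_prod hW hν hb0 hb1 hS hlam ht).1
  equation t ht := by
    obtain ⟨hint, hval⟩ := integrable_and_integral_caputo_prod hW hν hb0 hb1 hS hlam ht
    -- Absolute convergence permits Fubini, with the `r`-integral inside as in the Caputo
    -- derivative.
    rw [← hval, integral_prod _ hint, distributedDeriv]
    refine integral_congr_ae (Eventually.of_forall fun β => ?_)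
    simp only [caputoDeriv]
    rw [integral_const_mul]
  initial := by
    simpa using laplaceInverse_eq_integral hW hν hb0 hb1 hS hlam le_rfl

theorem abs_deriv_laplaceInverse_le {t : ℝ} (ht : 0 < t) :
    |deriv (fun r => laplaceInverse P W r lam) t| ≤
      lam * (((∫ β, Real.sin (β * Real.pi) ∂(orderMeasure μ)) * Real.pi)⁻¹ *
        (Real.Gamma (1 - b1) * t ^ (b1 - 1) + Real.Gamma (1 - b0) * t ^ (b0 - 1))) := by
  rw [deriv_laplaceInverse hW hν hb0 hb1 hS hlam ht, abs_neg, abs_mul, abs_of_pos hlam,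
    abs_of_nonneg ENNReal.toReal_nonneg]
  refine mul_le_mul_of_nonneg_left (ENNReal.toReal_le_of_le_ofReal ?_
    (resolventKernel_le hν hb0 hb1 hS hlam.le ht)) hlam.le
  obtain ⟨β, hβ⟩ : ∃ β, β ∈ Icc b0 b1 := by
    by_contra! hcon
    have : orderMeasure μ = 0 := by
      rw [← ae_eq_bot, ← empty_mem_iff_bot]
      filter_upwards [hν] with β hβ using hcon β hβ
    simp [this] at hS
  have hg : ∀ b : ℝ, b < 1 → 0 ≤ Real.Gamma (1 - b) * t ^ (b - 1) := fun b hb =>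
    mul_nonneg (Real.Gamma_nonneg_of_nonneg (by linarith)) (Real.rpow_nonneg ht.le _)
  exact mul_nonneg (inv_nonneg.2 (mul_nonneg hS.le Real.pi_pos.le))
    (add_nonneg (hg b1 hb1) (hg b0 ((hβ.1.trans hβ.2).trans_lt hb1)))

end Solution

/-! ### From the density `p` to the hypotheses on the order measure. -/

section Density

variable {p : ℝ → ℝ} {b0 b1 : ℝ}

theorem orderMeasure_eq_withDensity {μ : Measure ℝ} (hpm : Measurable p)
    (hμ : μ = (volume.restrict (Icc b0 b1)).withDensity fun β => ENNReal.ofReal (p β))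
    (hb0 : 0 < b0) (hb1 : b1 < 1) :
    orderMeasure μ = (volume.restrict (Icc b0 b1)).withDensity
      fun β => ENNReal.ofReal (Real.Gamma (1 - β) * p β) := by
  have hsub : Icc b0 b1 ⊆ Ioo 0 1 := fun β hβ => ⟨hb0.trans_le hβ.1, hβ.2.trans_lt hb1⟩
  have hΓ : AEMeasurable (fun β : ℝ => Real.Gamma (1 - β)) (volume.restrict (Icc b0 b1)) :=
    (continuousOn_Gamma_one_sub.mono (hsub.trans Ioo_subset_Iio_self)).aemeasurable
      measurableSet_Icc
  have hres : μ.restrict (Ioo 0 1) = μ := by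
    refine Measure.restrict_eq_self_of_ae_mem ?_
    rw [hμ]
    exact (withDensity_absolutelyContinuous _ _).ae_le
      ((ae_restrict_mem measurableSet_Icc).mono hsub)
  rw [orderMeasure, hres, hμ, ← withDensity_mul₀ (by fun_prop) hΓ.ennreal_ofReal]
  refine withDensity_congr_ae ?_
  filter_upwards [ae_restrict_mem measurableSet_Icc] with β hβ
  have : 0 ≤ Real.Gamma (1 - β) := Real.Gamma_nonneg_of_nonneg (by linarith [(hsub hβ).2])
  rw [Pi.mul_apply, mul_comm, ENNReal.ofReal_mul this]

theorem isFiniteMeasure_withDensity_of_continuousOn {g : ℝ → ℝ} (hg : ContinuousOn g (Icc b0 b1)) :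
    IsFiniteMeasure ((volume.restrict (Icc b0 b1)).withDensity fun β => ENNReal.ofReal (g β)) :=
  isFiniteMeasure_withDensity_ofReal hg.integrableOn_Icc.2

end Density

end DistributedOrder

end

theorem mainTheorem7 {Ω : Type*} [MeasurableSpace Ω] (P : Measure Ω) [IsProbabilityMeasure P]
    (W : ℝ≥0 → Ω → ℝ) (μ : Measure ℝ) (p : ℝ → ℝ) (b0 b1 : ℝ)
    (hW : DistributedOrder.IsSubordinator P W (DistributedOrder.mixtureLevyMeasure μ))
    (hpm : Measurable p) (hp0 : ∀ β, 0 ≤ p β)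
    (hμ : μ = volume.withDensity fun β => ENNReal.ofReal (p β))
    (hb0 : 0 < b0) (hb : b0 < b1) (hb1 : b1 < 1)
    (hsupp : μ.support = Icc b0 b1)
    (hC1 : ContDiffOn ℝ 1 (fun β => Real.Gamma (1 - β) * p β) (Icc b0 b1))
    (hC : 0 < DistributedOrder.boundConst b0 b1 p) :
    ∀ lam : ℝ, 0 < lam →
      (∀ t : ℝ, 0 < t →
        DifferentiableAt ℝ (fun r => DistributedOrder.laplaceInverse P W r lam) t ∧
        |deriv (fun r => DistributedOrder.laplaceInverse P W r lam) t| ≤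
          lam * DistributedOrder.boundFun b0 b1 p t) ∧
      DistributedOrder.IsClassicalEigenSolution μ lam
        (fun t => DistributedOrder.laplaceInverse P W t lam) := by
  have hsub : Icc b0 b1 ⊆ Iio 1 := fun β hβ => hβ.2.trans_lt hb1
  have hΓpos : ∀ β ∈ Icc b0 b1, 0 < Real.Gamma (1 - β) := fun β hβ =>
    Real.Gamma_pos_of_pos (sub_pos.2 (hsub hβ))
  have hμ' : μ = (volume.restrict (Icc b0 b1)).withDensity fun β => ENNReal.ofReal (p β) := by
    rw [← restrict_withDensity measurableSet_Icc, ← hμ]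
    -- A measure on the line is carried by its topological support, so `p` may be restricted to
    -- `[b0, b1]`.
    refine (Measure.restrict_eq_self_of_ae_mem ?_).symm
    rw [← hsupp]
    exact Measure.support_mem_ae
  -- Dividing by the positive continuous `Γ(1 - β)` shows that `p` is continuous on the compact
  -- interval, which makes `μ` finite.
  have hpc : ContinuousOn p (Icc b0 b1) := by
    refine (((DistributedOrder.continuousOn_Gamma_one_sub.mono hsub).inv₀
      fun β hβ => (hΓpos β hβ).ne').mul hC1.continuousOn).congr fun β hβ => ?_
    have := (hΓpos β hβ).ne'
    simp only [Pi.mul_apply, Pi.inv_apply]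
    field_simp
  have hν := DistributedOrder.orderMeasure_eq_withDensity hpm hμ' hb0 hb1
  have hfinμ : IsFiniteMeasure μ :=
    hμ' ▸ DistributedOrder.isFiniteMeasure_withDensity_of_continuousOn hpc
  have hfinν : IsFiniteMeasure (DistributedOrder.orderMeasure μ) :=
    hν ▸ DistributedOrder.isFiniteMeasure_withDensity_of_continuousOn hC1.continuousOn
  have hmem : ∀ᵐ β ∂(DistributedOrder.orderMeasure μ), β ∈ Icc b0 b1 := by
    rw [hν]
    exact (withDensity_absolutelyContinuous _ _).ae_le (ae_restrict_mem measurableSet_Icc)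
  -- The constant `C` is the sine integral against `ν`, since `ν` has density `Γ(1 - β) p(β)`.
  have hSeq : ∫ β, Real.sin (β * Real.pi) ∂(DistributedOrder.orderMeasure μ) =
      DistributedOrder.boundConst b0 b1 p := by
    rw [hν, integral_withDensity_eq_integral_toReal_smul₀
      (hC1.continuousOn.aemeasurable measurableSet_Icc).ennreal_ofReal
      (Filter.Eventually.of_forall fun _ => ENNReal.ofReal_lt_top),
      DistributedOrder.boundConst, intervalIntegral.integral_of_le hb.le,
      ← integral_Icc_eq_integral_Ioc]
    refine setIntegral_congr_fun measurableSet_Icc fun β hβ => ?_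
    simp only [smul_eq_mul]
    rw [ENNReal.toReal_ofReal (mul_nonneg (hΓpos β hβ).le (hp0 β))]
    ring
  have hS : 0 < ∫ β, Real.sin (β * Real.pi) ∂(DistributedOrder.orderMeasure μ) := hSeq ▸ hC
  intro lam hlam
  refine ⟨fun t ht => ⟨(DistributedOrder.hasDerivAt_laplaceInverse hW hmem hb0 hb1 hS hlam
    ht).differentiableAt, ?_⟩,
    DistributedOrder.isClassicalEigenSolution_laplaceInverse hW hmem hb0 hb1 hS hlam⟩
  have := DistributedOrder.abs_deriv_laplaceInverse_le hW hmem hb0 hb1 hS hlam ht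
  rwa [hSeq] at this
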